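/- Let $q\in\mathbb C$ with $0<|q|<1$. Write $(x;q)_\infty=\prod_{n\ge 0}(1-xq^n)$, $(x;q)_n=\prod_{k=0}^{n-1}(1-xq^k)$ for integers $n\ge 0$, and $(x_1,\dots,x_m;q)_n=(x_1;q)_n\cdots(x_m;q)_n$ (also for $n=\infty$). Put $$\theta(x)=\frac1{(q;q)_\infty}\sum_{n=-\infty}^{\infty}(-1)^nq^{n(n-1)/2}x^n\quad(x\ne 0),\qquad \Omega(x_1,\dots,x_n;a_1,\dots,a_m)=\prod_{i=1}^n\prod_{j=1}^m(x_i/a_j;q)_\infty .$$ Let ${}_8W_7[a;a_4,\dots,a_8;q,x]$ denote the very-well-poised basic hypergeometric series $${}_8W_7[a;a_4,\dots,a_8;q,x]=\sum_{n=0}^\infty \frac{1-aq^{2n}}{1-a}\,\frac{(a,a_4,\dots,a_8;q)_n}{(q,aq/a_4,\dots,aq/a_8;q)_n}\,x^n ,$$ where the factor $1-a$ is cancelled against $(a;q)_n$ for $n\ge 1$ and the term with $n=0$ is $1$ (so that $a=1$ is allowed). Let $a,c,d,e,z$ be nonzero complex numbers with $zq=cde$ and $|aq/z|<1$, such that no denominator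 below vanishes; that is, none of $aq/c,\ aq/d,\ aq/e,\ zq,\ q/a,\ q/c,\ q/d,\ q/e,\ aq/z^2,\ q/z,\ c/z,\ d/z,\ e/z$ is of the form $q^{-n}$ with an integer $n\ge 0$, and $a/z$ is not an integer power of $q$. Then both ${}_8W_7$ series below converge absolutely, and $$\begin{aligned} &{}_8W_7[a;c,d,e,a/z,z;q,aq/z]\\ &=\Big(1-\frac1z\Big)\frac{(q,aq,q/a,aq/z^2;q)_\infty}{\theta(a/z)\,(q/z;q)_\infty}\, \frac{\Omega(q;c,d,e)\,\Omega(aq;cd,ce,de)}{\Omega(aq;c,d,e,z)\,\Omega(1/z;1/c,1/d,1/e)}\; {}_8W_7[1/z;a/z,c/z,d/z,e/z,z/a;q,q]\\ &\quad+\frac1z\,\frac{(q,aq,q/a,a;q)_\infty}{\theta(a/z)\,(zq;q)_\infty}\, \frac{\Omega(1;1/c,1/d,1/e)\,\Omega(aq/z;c,d,e)}{\Omega(1/z;1/c,1/d,1/e)\,\Omega(aq;c,d,e,z)} . \end{aligned}$$ -/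

import Mathlib

namespace BasicHyp

/-- The infinite `q`-shifted factorial `(x; q)_∞ = ∏_{n ≥ 0} (1 - x q^n)` (used for `|q| < 1`). -/
noncomputable def qInf (q x : ℂ) : ℂ := ∏' n : ℕ, (1 - x * q ^ n)

/-- The finite `q`-shifted factorial `(x; q)_n = ∏_{0 ≤ k < n} (1 - x q^k)`, for `n ≥ 0`. -/
noncomputable def qFin (q x : ℂ) (n : ℕ) : ℂ := ∏ k ∈ Finset.range n, (1 - x * q ^ k)

/-- `(x₁, …, x_m; q)_∞`. -/
noncomputable def qInfs (q : ℂ) (xs : List ℂ) : ℂ := (xs.map (qInf q)).prod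

/-- `(x₁, …, x_m; q)_n`. -/
noncomputable def qFins (q : ℂ) (xs : List ℂ) (n : ℕ) : ℂ := (xs.map (fun x => qFin q x n)).prod

/-- The theta function
`θ(x) = (1 / (q; q)_∞) ∑_{n ∈ ℤ} (-1)^n q^{n(n-1)/2} x^n`, for `x ≠ 0`. -/
noncomputable def theta (q x : ℂ) : ℂ :=
  1 / qInf q q * ∑' n : ℤ, (-1 : ℂ) ^ n * q ^ (n * (n - 1) / 2) * x ^ n

/-- `Ω(x₁, …, x_n; a₁, …, a_m) = ∏_i ∏_j (x_i / a_j; q)_∞`. -/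
noncomputable def Omega (q : ℂ) (xs as : List ℂ) : ℂ :=
  (xs.map (fun x => (as.map (fun a => qInf q (x / a))).prod)).prod

/-- The `n`-th term of a basic hypergeometric series with upper parameters `as`, lower parameters
`bs` (one fewer than the upper ones), base `q` and argument `z`. -/
noncomputable def phiTerm (as bs : List ℂ) (q z : ℂ) (n : ℕ) : ℂ :=
  qFins q as n / qFins q bs n * (z ^ n / qFin q q n)

/-- The basic hypergeometric series `_{r+1}φ_r[as; bs; q, z]`. -/
noncomputable def phi (as bs : List ℂ) (q z : ℂ) : ℂ := ∑' n : ℕ, phiTerm as bs q z n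

/-- The very-well-poised factor
`(a, q√a, -q√a; q)_n / (√a, -√a; q)_n = (a; q)_n (1 - a q^{2n}) / (1 - a)`,
with the common factor `1 - a` of `(a; q)_n` and of the denominator cancelled, so that it also has
its usual value when `a = 1`. -/
noncomputable def vwpFactor (q a : ℂ) : ℕ → ℂ
  | 0 => 1
  | n + 1 => (1 - a * q ^ (2 * (n + 1))) * qFin q (a * q) n

/-- The `n`-th term of the very-well-poised series `_{r+1}W_r[a; l; q, z]`, where `l` is the list
of the parameters `a₄, …, a_{r+1}`. -/
noncomputable def WTerm (a : ℂ) (l : List ℂ) (q z : ℂ) (n : ℕ) : ℂ :=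
  vwpFactor q a n * qFins q l n / qFins q (l.map (fun x => a * q / x)) n * (z ^ n / qFin q q n)

/-- The very-well-poised basic hypergeometric series `_{r+1}W_r[a; a₄, …, a_{r+1}; q, z]`; for a
list `l` of five parameters it is an `_8W_7`. -/
noncomputable def W (a : ℂ) (l : List ℂ) (q z : ℂ) : ℂ := ∑' n : ℕ, WTerm a l q z n

theorem qFin_succ (q x : ℂ) (n : ℕ) : qFin q x (n + 1) = qFin q x n * (1 - x * q ^ n) := by
  simp [qFin, Finset.prod_range_succ]

theorem qFin_succ' (q x : ℂ) (n : ℕ) : qFin q x (n + 1) = (1 - x) * qFin q (x * q) n := by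
  simp only [qFin, Finset.prod_range_succ', pow_zero, mul_one]
  rw [mul_comm]
  congr 1
  refine Finset.prod_congr rfl fun k _ => ?_
  ring

theorem vwpFactor_spec (q s : ℂ) (n : ℕ) :
    qFin q (s ^ 2) n * (qFin q (q * s) n * qFin q (-(q * s)) n)
      = vwpFactor q (s ^ 2) n * (qFin q s n * qFin q (-s) n) := by
  cases n with
  | zero => simp [qFin, vwpFactor]
  | succ n =>
    rw [qFin_succ q (q * s), qFin_succ q (-(q * s)), qFin_succ' q (s ^ 2), qFin_succ' q s,
      qFin_succ' q (-s), vwpFactor, mul_comm s q, show -s * q = -(q * s) by ring]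
    ring

theorem vwpFactor_eq (q a : ℂ) (ha : a ≠ 1) (n : ℕ) :
    vwpFactor q a n = qFin q a n * (1 - a * q ^ (2 * n)) / (1 - a) := by
  have h : 1 - a ≠ 0 := sub_ne_zero.2 (Ne.symm ha)
  cases n with
  | zero => simp [qFin, vwpFactor, h]
  | succ n =>
    rw [qFin_succ', vwpFactor]
    field_simp

/-- `W` is the very-well-poised `φ` series with `a₂ = q√a` and `a₃ = -q√a`, whenever the lower
parameters `√a` and `-√a` of the latter are admissible. -/
theorem W_eq_phi (a s q z : ℂ) (l : List ℂ) (hs : s ^ 2 = a)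
    (h₁ : ∀ n : ℕ, s * q ^ n ≠ 1) (h₂ : ∀ n : ℕ, -s * q ^ n ≠ 1) :
    W a l q z
      = phi (a :: (q * s) :: (-(q * s)) :: l) (s :: (-s) :: l.map (fun x => a * q / x)) q z := by
  subst hs
  unfold W phi
  congr 1
  funext n
  have e₁ : qFin q s n ≠ 0 := Finset.prod_ne_zero_iff.2 fun k _ => sub_ne_zero.2 (h₁ k).symm
  have e₂ : qFin q (-s) n ≠ 0 := Finset.prod_ne_zero_iff.2 fun k _ => sub_ne_zero.2 (h₂ k).symm
  have key : vwpFactor q (s ^ 2) n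
      = qFin q (s ^ 2) n * (qFin q (q * s) n * qFin q (-(q * s)) n)
        / (qFin q s n * qFin q (-s) n) := by
    rw [vwpFactor_spec]
    field_simp
  unfold WTerm phiTerm
  rw [key]
  simp only [qFins, List.map_cons, List.prod_cons]
  simp only [div_eq_mul_inv, mul_inv]
  ring

end BasicHyp

namespace BasicHyp

open Filter Topology


section QPochhammer

theorem summable_norm_mul_qpow {q : ℂ} (hq : ‖q‖ < 1) (x : ℂ) :
    Summable fun n : ℕ => ‖-(x * q ^ n)‖ := by
  simp only [norm_neg, norm_mul, norm_pow]
  exact (summable_geometric_of_lt_one (norm_nonneg _) hq).mul_left _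

theorem multipliable_qInf {q : ℂ} (hq : ‖q‖ < 1) (x : ℂ) :
    Multipliable fun n : ℕ => 1 - x * q ^ n := by
  simpa [sub_eq_add_neg] using multipliable_one_add_of_summable (summable_norm_mul_qpow hq x)

theorem qFin_mul_qInf {q : ℂ} (hq : ‖q‖ < 1) (x : ℂ) (n : ℕ) :
    qFin q x n * qInf q (x * q ^ n) = qInf q x := by
  have h := Multipliable.prod_mul_tprod_nat_mul' (f := fun n : ℕ => 1 - x * q ^ n) (k := n) (by
    have := multipliable_qInf hq (x * q ^ n)
    refine this.congr fun m => ?_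
    ring)
  rw [qInf, qInf, qFin, ← h]
  congr 1
  refine tprod_congr fun m => ?_
  ring

theorem qInf_eq_mul {q : ℂ} (hq : ‖q‖ < 1) (x : ℂ) :
    qInf q x = (1 - x) * qInf q (x * q) := by
  have := qFin_mul_qInf hq x 1
  simpa [qFin] using this.symm

theorem qInf_ne_zero {q : ℂ} (hq : ‖q‖ < 1) {x : ℂ} (h : ∀ n : ℕ, x * q ^ n ≠ 1) :
    qInf q x ≠ 0 := by
  have := tprod_one_add_ne_zero_of_summable (f := fun n : ℕ => -(x * q ^ n))
    (fun i => by rw [← sub_eq_add_neg]; exact sub_ne_zero.2 (h i).symm)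
    (summable_norm_mul_qpow hq x)
  simpa [qInf, sub_eq_add_neg] using this

theorem qInf_eq_zero {q : ℂ} (hq : ‖q‖ < 1) {x : ℂ} (n : ℕ) (h : x * q ^ n = 1) :
    qInf q x = 0 := by
  rw [← qFin_mul_qInf hq x (n + 1), qFin_succ, h]
  simp

theorem qFin_ne_zero {q x : ℂ} (h : ∀ n : ℕ, x * q ^ n ≠ 1) (n : ℕ) : qFin q x n ≠ 0 :=
  Finset.prod_ne_zero_iff.2 fun k _ => sub_ne_zero.2 (h k).symm

@[simp] theorem qFin_zero (q x : ℂ) : qFin q x 0 = 1 := by simp [qFin]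

@[simp] theorem qInf_zero (q : ℂ) : qInf q 0 = 1 := by simp [qInf]

theorem tendsto_qFin {q : ℂ} (hq : ‖q‖ < 1) (x : ℂ) :
    Tendsto (qFin q x) atTop (𝓝 (qInf q x)) :=
  (multipliable_qInf hq x).hasProd.tendsto_prod_nat

/-- A bound for all finite and infinite `q`-shifted factorials of numbers of norm at most `r`. -/
noncomputable def qBound (q : ℂ) (r : ℝ) : ℝ := Real.exp (r * (1 - ‖q‖)⁻¹)

theorem norm_qFin_le {q : ℂ} (hq : ‖q‖ < 1) {x : ℂ} {r : ℝ} (hx : ‖x‖ ≤ r) (n : ℕ) :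
    ‖qFin q x n‖ ≤ qBound q r := by
  have hr : 0 ≤ r := (norm_nonneg x).trans hx
  have hs := (hasSum_geometric_of_lt_one (norm_nonneg q) hq)
  calc ‖qFin q x n‖ = ∏ k ∈ Finset.range n, ‖1 - x * q ^ k‖ := by rw [qFin, norm_prod]
    _ ≤ ∏ k ∈ Finset.range n, Real.exp (r * ‖q‖ ^ k) := by
        refine Finset.prod_le_prod (fun _ _ => norm_nonneg _) fun k _ => ?_
        calc ‖1 - x * q ^ k‖ ≤ ‖(1 : ℂ)‖ + ‖x * q ^ k‖ := norm_sub_le _ _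
          _ ≤ r * ‖q‖ ^ k + 1 := by
              rw [norm_one, norm_mul, norm_pow, add_comm]
              gcongr
          _ ≤ _ := Real.add_one_le_exp _
    _ = Real.exp (r * ∑ k ∈ Finset.range n, ‖q‖ ^ k) := by
        rw [← Real.exp_sum, Finset.mul_sum]
    _ ≤ qBound q r := by
        rw [qBound]
        gcongr
        rw [← hs.tsum_eq]
        exact hs.summable.sum_le_tsum _ fun i _ => by positivity

theorem norm_qInf_le {q : ℂ} (hq : ‖q‖ < 1) {x : ℂ} {r : ℝ} (hx : ‖x‖ ≤ r) :
    ‖qInf q x‖ ≤ qBound q r :=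
  le_of_tendsto (tendsto_qFin hq x).norm (Eventually.of_forall fun n => norm_qFin_le hq hx n)

theorem differentiable_qFin (q : ℂ) (n : ℕ) : Differentiable ℂ fun x => qFin q x n := by
  unfold qFin
  fun_prop

theorem differentiable_qInf {q : ℂ} (hq : ‖q‖ < 1) : Differentiable ℂ (qInf q) := by
  intro x₀
  have hs : Summable fun n : ℕ => (‖x₀‖ + 1) * ‖q‖ ^ n :=
    (summable_geometric_of_lt_one (norm_nonneg _) hq).mul_left _
  have h := (Summable.hasProdLocallyUniformlyOn_nat_one_add (f := fun (n : ℕ) (x : ℂ) => -(x * q ^ n))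
    (K := Metric.ball (0 : ℂ) (‖x₀‖ + 1)) Metric.isOpen_ball hs
    (Eventually.of_forall fun n x hx => by
      have : ‖x‖ < ‖x₀‖ + 1 := by simpa using hx
      rw [norm_neg, norm_mul, norm_pow]
      gcongr)
    (fun n => by fun_prop))
  have h2 := h.tendstoLocallyUniformlyOn_finsetRange.differentiableOn
    (Eventually.of_forall fun n => by fun_prop) Metric.isOpen_ball
  have h3 := h2.differentiableAt (Metric.isOpen_ball.mem_nhds (by simp : x₀ ∈ _))
  have h4 : qInf q = fun x => ∏' n : ℕ, (1 + -(x * q ^ n)) := by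
    funext x
    simp [qInf, sub_eq_add_neg]
  rwa [h4]

end QPochhammer


section JacobiTripleProduct

/-- The `k`-th term of the theta series. -/
noncomputable def thetaTerm (q x : ℂ) (k : ℤ) : ℂ :=
  (-1 : ℂ) ^ k * q ^ (k * (k - 1) / 2) * x ^ k

theorem thetaTerm_succ {q x : ℂ} (hq0 : q ≠ 0) (hx : x ≠ 0) (k : ℤ) :
    thetaTerm q x (k + 1) = -x * q ^ k * thetaTerm q x k := by
  have h : (k + 1) * (k + 1 - 1) / 2 = k * (k - 1) / 2 + k := by
    rw [← Int.add_mul_ediv_right _ _ (by norm_num : (2 : ℤ) ≠ 0)]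
    congr 1
    ring
  rw [thetaTerm, thetaTerm, h, zpow_add₀ hq0, zpow_add_one₀ hx, zpow_add_one₀ (by norm_num)]
  ring

theorem thetaTerm_ne_zero {q x : ℂ} (hq0 : q ≠ 0) (hx : x ≠ 0) (k : ℤ) : thetaTerm q x k ≠ 0 :=
  mul_ne_zero (mul_ne_zero (zpow_ne_zero _ (by norm_num)) (zpow_ne_zero _ hq0)) (zpow_ne_zero _ hx)

theorem summable_norm_thetaTerm {q x : ℂ} (hq0 : q ≠ 0) (hq : ‖q‖ < 1) (hx : x ≠ 0) :
    Summable fun k : ℤ => ‖thetaTerm q x k‖ := by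
  have hpow : Tendsto (fun n : ℕ => ‖q‖ ^ n) atTop (𝓝 0) :=
    tendsto_pow_atTop_nhds_zero_of_lt_one (norm_nonneg _) hq
  refine Summable.of_nat_of_neg ?_ ?_
  · refine summable_of_ratio_test_tendsto_lt_one zero_lt_one
      (Eventually.of_forall fun n => norm_ne_zero_iff.2 (thetaTerm_ne_zero hq0 hx _)) ?_
    have : Tendsto (fun n : ℕ => ‖x‖ * ‖q‖ ^ n) atTop (𝓝 0) := by simpa using hpow.const_mul ‖x‖
    refine this.congr fun n => ?_
    have h0 := norm_ne_zero_iff.2 (thetaTerm_ne_zero hq0 hx n)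
    push_cast
    rw [thetaTerm_succ hq0 hx]
    simp [h0]
  · refine summable_of_ratio_test_tendsto_lt_one zero_lt_one
      (Eventually.of_forall fun n => norm_ne_zero_iff.2 (thetaTerm_ne_zero hq0 hx _)) ?_
    have : Tendsto (fun n : ℕ => ‖x‖⁻¹ * ‖q‖ * ‖q‖ ^ n) atTop (𝓝 0) := by
      simpa using hpow.const_mul (‖x‖⁻¹ * ‖q‖)
    refine this.congr fun n => ?_
    have h0 := norm_ne_zero_iff.2 (thetaTerm_ne_zero hq0 hx (-((n + 1 : ℕ) : ℤ)))
    have h1 := thetaTerm_succ hq0 hx (-((n + 1 : ℕ) : ℤ))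
    have h2 : -((n + 1 : ℕ) : ℤ) + 1 = -(n : ℤ) := by push_cast; ring
    rw [h2] at h1
    have h3 : ‖x‖ ≠ 0 := norm_ne_zero_iff.2 hx
    have h4 : ‖q‖ ≠ 0 := norm_ne_zero_iff.2 hq0
    rw [h1, norm_norm, norm_norm, norm_mul, norm_mul, norm_neg, norm_zpow, zpow_neg, zpow_natCast,
      pow_succ']
    field_simp

/-- The reciprocal of `(q; q)_m`, extended by zero to negative `m`. -/
noncomputable def qFactInv (q : ℂ) (m : ℤ) : ℂ := if m < 0 then 0 else 1 / qFin q q m.toNat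

theorem self_mul_qpow_ne_one {q : ℂ} (hq : ‖q‖ < 1) (n : ℕ) : q * q ^ n ≠ 1 := fun h => by
  have h1 : ‖q ^ (n + 1)‖ = 1 := by rw [pow_succ', h, norm_one]
  rw [norm_pow] at h1
  exact (pow_lt_one₀ (norm_nonneg q) hq n.succ_ne_zero).ne h1

theorem qFactInv_sub_one {q : ℂ} (hq : ‖q‖ < 1) (m : ℤ) :
    qFactInv q (m - 1) = (1 - q ^ m) * qFactInv q m := by
  rcases lt_trichotomy m 0 with h | rfl | h
  · simp [qFactInv, h, show m - 1 < 0 by lia]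
  · simp [qFactInv]
  · obtain ⟨n, rfl⟩ : ∃ n : ℕ, m = n + 1 := ⟨(m - 1).toNat, by lia⟩
    have h1 := qFin_ne_zero (self_mul_qpow_ne_one hq) (n + 1)
    rw [qFactInv, qFactInv, if_neg (by lia), if_neg (by lia), show ((n : ℤ) + 1 - 1).toNat = n by lia,
      show ((n : ℤ) + 1).toNat = n + 1 by lia, show ((n : ℤ) + 1) = ((n + 1 : ℕ) : ℤ) by push_cast; rfl,
      zpow_natCast]
    rw [qFin_succ] at h1 ⊢
    have h2 := left_ne_zero_of_mul h1
    have h3 := right_ne_zero_of_mul h1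
    rw [pow_succ']
    field_simp

theorem norm_qFactInv_le {q : ℂ} (hq : ‖q‖ < 1) (m : ℤ) :
    ‖qFactInv q m‖ ≤ qBound q 1 / ‖qInf q q‖ := by
  have h0 := qInf_ne_zero hq (self_mul_qpow_ne_one hq)
  have hB : 0 ≤ qBound q 1 := (Real.exp_pos _).le
  rw [qFactInv]
  split_ifs with h
  · simpa using by positivity
  · have h1 := qFin_mul_qInf hq q m.toNat
    have h2 := qFin_ne_zero (self_mul_qpow_ne_one hq) m.toNat
    rw [show 1 / qFin q q m.toNat = qInf q (q * q ^ m.toNat) / qInf q q by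
      rw [← h1] at h0 ⊢
      have := right_ne_zero_of_mul h0
      field_simp, norm_div]
    gcongr
    refine norm_qInf_le hq ?_
    rw [← pow_succ', norm_pow]
    exact pow_le_one₀ (norm_nonneg _) hq.le

theorem tendsto_qFactInv {q : ℂ} (hq : ‖q‖ < 1) {u : ℕ → ℤ} (hu : Tendsto u atTop atTop) :
    Tendsto (fun n => qFactInv q (u n)) atTop (𝓝 (1 / qInf q q)) := by
  have h1 : Tendsto (fun n => 1 / qFin q q (u n).toNat) atTop (𝓝 (1 / qInf q q)) := by
    refine tendsto_const_nhds.div ((tendsto_qFin hq q).comp ?_)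
      (qInf_ne_zero hq (self_mul_qpow_ne_one hq))
    exact tendsto_atTop.2 fun b => (hu.eventually_ge_atTop (b : ℤ)).mono fun n hn => by lia
  refine h1.congr' ?_
  filter_upwards [hu.eventually_ge_atTop 0] with n hn
  rw [qFactInv, if_neg (by lia)]

theorem hasSum_finite_tripleProduct {q x : ℂ} (hq0 : q ≠ 0) (hq : ‖q‖ < 1) (hx : x ≠ 0) (n : ℕ) :
    HasSum (fun k : ℤ => qFin q q (2 * n) * qFactInv q (n + k) * qFactInv q (n - k) * thetaTerm q x k)
      (qFin q x n * qFin q (q / x) n) := by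
  induction n with
  | zero =>
    have := hasSum_single (f := fun k : ℤ => qFin q q (2 * 0) * qFactInv q ((0 : ℕ) + k) *
      qFactInv q ((0 : ℕ) - k) * thetaTerm q x k) 0 (fun k hk => by
        rcases lt_or_gt_of_ne hk with h | h <;> simp [qFactInv, h])
    simpa [qFactInv, thetaTerm] using this
  | succ n ih =>
    have h1 := ih.mul_left (1 + q ^ (2 * n + 1))
    have h2 := ((Equiv.subRight (1 : ℤ)).hasSum_iff.2 ih).mul_left (-x * q ^ n)
    have h3 := ((Equiv.addRight (1 : ℤ)).hasSum_iff.2 ih).mul_left (-q ^ (n + 1) / x)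
    have h4 := (h1.add h2).add h3
    rw [show (1 + q ^ (2 * n + 1)) * (qFin q x n * qFin q (q / x) n) +
        -x * q ^ n * (qFin q x n * qFin q (q / x) n) +
        -q ^ (n + 1) / x * (qFin q x n * qFin q (q / x) n) =
        qFin q x (n + 1) * qFin q (q / x) (n + 1) by
      rw [qFin_succ, qFin_succ]
      field_simp
      ring] at h4
    · refine Eq.subst (motive := fun f => HasSum f _) (Eq.symm (funext fun k => ?_)) h4
      simp only [Function.comp_apply, Equiv.subRight_apply, Equiv.coe_addRight]
      have e1 : thetaTerm q x k = -x * q ^ (k - 1) * thetaTerm q x (k - 1) := by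
        rw [← thetaTerm_succ hq0 hx, sub_add_cancel]
      have e2 := thetaTerm_succ hq0 hx k
      have a1 := qFactInv_sub_one hq (n + 1 + k)
      have a2 := qFactInv_sub_one hq (n + k)
      have b1 := qFactInv_sub_one hq (n + 1 - k)
      have b2 := qFactInv_sub_one hq (n - k)
      rw [show (n : ℤ) + 1 + k - 1 = n + k by ring] at a1
      rw [show (n : ℤ) + 1 - k - 1 = n - k by ring] at b1
      rw [a1] at a2
      rw [b1] at b2
      push_cast
      rw [show (n : ℤ) + (k - 1) = n + k - 1 by ring, show (n : ℤ) - (k - 1) = n + 1 - k by ring,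
        show (n : ℤ) + (k + 1) = n + 1 + k by ring, show (n : ℤ) - (k + 1) = n - k - 1 by ring,
        a1, a2, b1, b2, e2, show 2 * (n + 1) = 2 * n + 1 + 1 by ring, qFin_succ, qFin_succ]
      have t : x * thetaTerm q x (k - 1) = - q ^ (1 - k) * thetaTerm q x k := by
        rw [e1, show 1 - k = -(k - 1) by ring, zpow_neg]
        have := zpow_ne_zero (k - 1) hq0
        field_simp
      have z1 : q ^ ((n : ℤ) + k) = q ^ n * q ^ k := by rw [zpow_add₀ hq0, zpow_natCast]
      have z2 : q ^ ((n : ℤ) - k) = q ^ n / q ^ k := by rw [zpow_sub₀ hq0, zpow_natCast]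
      have z3 : q ^ ((n : ℤ) + 1 + k) = q * q ^ n * q ^ k := by
        rw [zpow_add₀ hq0, zpow_add₀ hq0, zpow_natCast, zpow_one, mul_comm q]
      have z4 : q ^ ((n : ℤ) + 1 - k) = q * q ^ n / q ^ k := by
        rw [zpow_sub₀ hq0, zpow_add₀ hq0, zpow_natCast, zpow_one, mul_comm q]
      have z5 : q ^ (1 - k) = q / q ^ k := by rw [zpow_sub₀ hq0, zpow_one]
      rw [z5] at t
      rw [z1, z2, z3, z4]
      have hk := zpow_ne_zero k hq0
      generalize qFin q q (2 * n) = Q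
      generalize qFactInv q (n + 1 + k) = A
      generalize qFactInv q (n + 1 - k) = B
      generalize thetaTerm q x (k - 1) = T' at t
      generalize thetaTerm q x k = T at t
      generalize q ^ k = K at *
      have t' : T' = - (q / K) * T / x := by rw [← t]; field_simp
      rw [t', show q ^ (2 * n + 1) = q * (q ^ n) ^ 2 by ring, show q ^ (2 * n) = (q ^ n) ^ 2 by ring,
        show q ^ (n + 1) = q * q ^ n by ring]
      generalize q ^ n = N
      field_simp
      ring

/-- The Jacobi triple product identity. -/
theorem theta_eq_mul {q x : ℂ} (hq0 : q ≠ 0) (hq : ‖q‖ < 1) (hx : x ≠ 0) :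
    theta q x = qInf q x * qInf q (q / x) := by
  have hQ := qInf_ne_zero hq (self_mul_qpow_ne_one hq)
  have hlim : Tendsto (fun n : ℕ => ∑' k : ℤ,
      qFin q q (2 * n) * qFactInv q (n + k) * qFactInv q (n - k) * thetaTerm q x k) atTop
      (𝓝 (∑' k : ℤ, qInf q q * (1 / qInf q q) * (1 / qInf q q) * thetaTerm q x k)) := by
    refine tendsto_tsum_of_dominated_convergence
      (bound := fun k => qBound q 1 * (qBound q 1 / ‖qInf q q‖) * (qBound q 1 / ‖qInf q q‖) *
        ‖thetaTerm q x k‖) ((summable_norm_thetaTerm hq0 hq hx).mul_left _) ?_ ?_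
    · intro k
      have hn : Tendsto (fun n : ℕ => (n : ℤ)) atTop atTop := tendsto_natCast_atTop_atTop
      refine Tendsto.mul_const _ (((((tendsto_qFin hq q).comp ?_)).mul
        (tendsto_qFactInv hq ?_)).mul (tendsto_qFactInv hq ?_))
      · exact tendsto_id.const_mul_atTop' (by norm_num : 0 < 2)
      · exact tendsto_atTop_add_const_right _ _ hn
      · simpa only [sub_eq_add_neg] using tendsto_atTop_add_const_right _ (-k) hn
    · refine Eventually.of_forall fun n k => ?_
      rw [norm_mul, norm_mul, norm_mul]
      have := norm_qFin_le hq (x := q) (r := 1) hq.le (2 * n)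
      have hB : 0 ≤ qBound q 1 := (Real.exp_pos _).le
      gcongr <;> exact norm_qFactInv_le hq _
  have hlim' := hlim.congr fun n => (hasSum_finite_tripleProduct hq0 hq hx n).tsum_eq
  have := tendsto_nhds_unique hlim' ((tendsto_qFin hq x).mul (tendsto_qFin hq (q / x)))
  rw [← this, tsum_mul_left, theta]
  simp only [thetaTerm]
  field_simp

end JacobiTripleProduct


section UniformBounds

/-- The family `f` is bounded on `s`, uniformly in the index. -/
def UnifBdd (s : Set ℂ) (f : ℕ → ℂ → ℂ) : Prop := ∃ C : ℝ, ∀ n, ∀ a ∈ s, ‖f n a‖ ≤ C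

theorem UnifBdd.mul {s : Set ℂ} {f g : ℕ → ℂ → ℂ} (hf : UnifBdd s f) (hg : UnifBdd s g) :
    UnifBdd s fun n a => f n a * g n a := by
  obtain ⟨C, hC⟩ := hf
  obtain ⟨D, hD⟩ := hg
  refine ⟨C * D, fun n a ha => ?_⟩
  rw [norm_mul]
  exact mul_le_mul (hC n a ha) (hD n a ha) (norm_nonneg _) ((norm_nonneg _).trans (hC n a ha))

theorem unifBdd_qFin {q : ℂ} (hq : ‖q‖ < 1) {K : Set ℂ} (hK : IsCompact K) {g : ℂ → ℂ}
    (hg : ContinuousOn g K) : UnifBdd K fun n a => qFin q (g a) n := by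
  obtain ⟨r, hr⟩ := hK.exists_bound_of_continuousOn hg
  exact ⟨qBound q r, fun n a ha => norm_qFin_le hq (hr a ha) n⟩

theorem unifBdd_qInf {q : ℂ} (hq : ‖q‖ < 1) {K : Set ℂ} (hK : IsCompact K) {g : ℂ → ℂ}
    (hg : ContinuousOn g K) : UnifBdd K fun n a => qInf q (g a * q ^ n) := by
  obtain ⟨r, hr⟩ := hK.exists_bound_of_continuousOn hg
  refine ⟨qBound q r, fun n a ha => norm_qInf_le hq ?_⟩
  rw [norm_mul, norm_pow]
  exact (mul_le_of_le_one_right (norm_nonneg _) (pow_le_one₀ (norm_nonneg _) hq.le)).trans (hr a ha)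

theorem unifBdd_vwpFactor {q : ℂ} (hq : ‖q‖ < 1) {K : Set ℂ} (hK : IsCompact K) {g : ℂ → ℂ}
    (hg : ContinuousOn g K) : UnifBdd K fun n a => vwpFactor q (g a) n := by
  obtain ⟨r, hr⟩ := hK.exists_bound_of_continuousOn hg
  refine ⟨(1 + |r|) * qBound q |r|, fun n a ha => ?_⟩
  have hr' : ‖g a‖ ≤ |r| := (hr a ha).trans (le_abs_self r)
  have hmul : ∀ m : ℕ, ‖g a * q ^ m‖ ≤ |r| := fun m => by
    rw [norm_mul, norm_pow]
    exact (mul_le_of_le_one_right (norm_nonneg _) (pow_le_one₀ (norm_nonneg _) hq.le)).trans hr'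
  have hB : 1 ≤ qBound q |r| :=
    Real.one_le_exp (mul_nonneg (abs_nonneg _) (inv_nonneg.2 (sub_nonneg.2 hq.le)))
  cases n with
  | zero =>
    simp only [vwpFactor, norm_one]
    nlinarith [abs_nonneg r]
  | succ n =>
    simp only [vwpFactor]
    rw [norm_mul]
    refine mul_le_mul ((norm_sub_le _ _).trans ?_) (norm_qFin_le hq ?_ n) (norm_nonneg _)
      (by positivity)
    · rw [norm_one]
      linarith [hmul (2 * (n + 1))]
    · simpa using hmul 1

theorem differentiableOn_vwpFactor (q : ℂ) (n : ℕ) {U : Set ℂ} {g : ℂ → ℂ}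
    (hg : DifferentiableOn ℂ g U) : DifferentiableOn ℂ (fun a => vwpFactor q (g a) n) U := by
  cases n with
  | zero => simp only [vwpFactor]; fun_prop
  | succ n =>
    simp only [vwpFactor]
    exact (by fun_prop : DifferentiableOn ℂ (fun a => 1 - g a * q ^ (2 * (n + 1))) U).mul
      ((differentiable_qFin q n).comp_differentiableOn (hg.mul_const q))

theorem differentiableOn_qFin (q : ℂ) (n : ℕ) {U : Set ℂ} {g : ℂ → ℂ}
    (hg : DifferentiableOn ℂ g U) : DifferentiableOn ℂ (fun a => qFin q (g a) n) U :=
  (differentiable_qFin q n).comp_differentiableOn hg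

theorem differentiableOn_qInf {q : ℂ} (hq : ‖q‖ < 1) {U : Set ℂ} {g : ℂ → ℂ}
    (hg : DifferentiableOn ℂ g U) : DifferentiableOn ℂ (fun a => qInf q (g a)) U :=
  (differentiable_qInf hq).comp_differentiableOn hg

theorem norm_le_geometric_of_unifBdd {U K : Set ℂ} (hKU : K ⊆ U) (hK : IsCompact K)
    {h : ℕ → ℂ → ℂ} {g : ℂ → ℂ} (hb : UnifBdd K h) (hg : ContinuousOn g U)
    (hg1 : ∀ a ∈ U, ‖g a‖ < 1) :
    ∃ C ρ : ℝ, 0 ≤ ρ ∧ ρ < 1 ∧ ∀ n, ∀ a ∈ K, ‖h n a * g a ^ n‖ ≤ C * ρ ^ n := by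
  obtain ⟨C, hC⟩ := hb
  rcases K.eq_empty_or_nonempty with rfl | hne
  · exact ⟨0, 0, le_rfl, zero_lt_one, by simp⟩
  obtain ⟨b, hbK, hmax⟩ := hK.exists_isMaxOn hne (hg.mono hKU).norm
  refine ⟨C, ‖g b‖, norm_nonneg _, hg1 b (hKU hbK), fun n a ha => ?_⟩
  rw [norm_mul, norm_pow]
  exact mul_le_mul (hC n a ha) (pow_le_pow_left₀ (norm_nonneg _) (hmax ha) n) (by positivity)
    ((norm_nonneg _).trans (hC n a ha))

theorem summable_of_unifBdd {U : Set ℂ} {h : ℕ → ℂ → ℂ} {g : ℂ → ℂ}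
    (hb : ∀ K ⊆ U, IsCompact K → UnifBdd K h) (hg : ContinuousOn g U)
    (hg1 : ∀ a ∈ U, ‖g a‖ < 1) {a : ℂ} (ha : a ∈ U) : Summable fun n => h n a * g a ^ n := by
  have hKU : ({a} : Set ℂ) ⊆ U := by simpa using ha
  obtain ⟨C, ρ, h0, h1, hle⟩ := norm_le_geometric_of_unifBdd hKU isCompact_singleton
    (hb _ hKU isCompact_singleton) hg hg1
  exact Summable.of_norm_bounded ((summable_geometric_of_lt_one h0 h1).mul_left C)
    fun n => hle n a rfl

theorem differentiableOn_tsum_of_unifBdd {U : Set ℂ} (hU : IsOpen U) {h : ℕ → ℂ → ℂ} {g : ℂ → ℂ}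
    (hh : ∀ n, DifferentiableOn ℂ (h n) U) (hb : ∀ K ⊆ U, IsCompact K → UnifBdd K h)
    (hg : DifferentiableOn ℂ g U) (hg1 : ∀ a ∈ U, ‖g a‖ < 1) :
    DifferentiableOn ℂ (fun a => ∑' n, h n a * g a ^ n) U := by
  intro a ha
  obtain ⟨K, hKn, hK, hKU⟩ := exists_mem_nhds_isCompact_mapsTo (f := id) continuous_id (hU.mem_nhds ha)
  obtain ⟨C, ρ, h0, h1, hle⟩ := norm_le_geometric_of_unifBdd hKU hK (hb K hKU hK) hg.continuousOn hg1
  have hi : interior K ⊆ U := interior_subset.trans hKU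
  have := Complex.differentiableOn_tsum_of_summable_norm (F := fun n a => h n a * g a ^ n)
    ((summable_geometric_of_lt_one h0 h1).mul_left C)
    (fun n => ((hh n).mul (hg.pow n)).mono hi) isOpen_interior
    (fun n w hw => hle n w (interior_subset hw))
  exact (this.differentiableAt (isOpen_interior.mem_nhds (mem_interior_iff_mem_nhds.2 hKn))).differentiableWithinAt

end UniformBounds

section Series

/-- The terms of `₈W₇[a; c, d, e, a/z, z; q, aq/z]`, multiplied by
`(aq/c, aq/d, aq/e, aq/z, zq, q; q)_∞`, without the power of the argument. -/
noncomputable def leftCoeff (q c d e z : ℂ) (n : ℕ) (a : ℂ) : ℂ :=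
  vwpFactor q a n * qFin q c n * qFin q d n * qFin q e n * qFin q (a / z) n * qFin q z n *
    qInf q (a * q / c * q ^ n) * qInf q (a * q / d * q ^ n) * qInf q (a * q / e * q ^ n) *
    qInf q (a * q / z * q ^ n) * qInf q (z * q * q ^ n) * qInf q (q * q ^ n)

/-- The terms of `₈W₇[1/z; a/z, c/z, d/z, e/z, z/a; q, q]`, multiplied by
`(q/a, q/c, q/d, q/e, aq/z², q; q)_∞`, without the power of the argument. -/
noncomputable def rightCoeff (q c d e z : ℂ) (n : ℕ) (a : ℂ) : ℂ :=
  vwpFactor q (1 / z) n * qFin q (c / z) n * qFin q (d / z) n * qFin q (e / z) n *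
    qFin q (a / z) n * qFin q (z / a) n *
    qInf q (q / c * q ^ n) * qInf q (q / d * q ^ n) * qInf q (q / e * q ^ n) *
    qInf q (q / a * q ^ n) * qInf q (a * q / z ^ 2 * q ^ n) * qInf q (q * q ^ n)

/-- The terms of `₆W₅[a; c, d, e; q, a/z]`, multiplied by `(aq/c, aq/d, aq/e, q; q)_∞`, without
the power of the argument. -/
noncomputable def sixCoeff (q c d e : ℂ) (n : ℕ) (a : ℂ) : ℂ :=
  vwpFactor q a n * qFin q c n * qFin q d n * qFin q e n *
    qInf q (a * q / c * q ^ n) * qInf q (a * q / d * q ^ n) * qInf q (a * q / e * q ^ n) *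
    qInf q (q * q ^ n)

noncomputable def leftSum (q c d e z a : ℂ) : ℂ := ∑' n, leftCoeff q c d e z n a * (a * q / z) ^ n

noncomputable def rightSum (q c d e z a : ℂ) : ℂ := ∑' n, rightCoeff q c d e z n a * q ^ n

noncomputable def sixSum (q c d e z a : ℂ) : ℂ := ∑' n, sixCoeff q c d e n a * (a / z) ^ n

theorem isOpen_norm_lt_one {g : ℂ → ℂ} (hg : Continuous g) : IsOpen {a : ℂ | ‖g a‖ < 1} :=
  isOpen_lt hg.norm continuous_const

variable {q : ℂ} (c d e z : ℂ)

theorem unifBdd_leftCoeff (hq : ‖q‖ < 1) {K : Set ℂ} (hK : IsCompact K) :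
    UnifBdd K (leftCoeff q c d e z) := by
  unfold leftCoeff
  iterate 6 refine UnifBdd.mul ?_ (unifBdd_qInf hq hK (by fun_prop))
  iterate 5 refine UnifBdd.mul ?_ (unifBdd_qFin hq hK (by fun_prop))
  exact unifBdd_vwpFactor hq hK (by fun_prop)

theorem unifBdd_sixCoeff (hq : ‖q‖ < 1) {K : Set ℂ} (hK : IsCompact K) :
    UnifBdd K (sixCoeff q c d e) := by
  unfold sixCoeff
  iterate 4 refine UnifBdd.mul ?_ (unifBdd_qInf hq hK (by fun_prop))
  iterate 3 refine UnifBdd.mul ?_ (unifBdd_qFin hq hK (by fun_prop))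
  exact unifBdd_vwpFactor hq hK (by fun_prop)

theorem continuousOn_const_div {K : Set ℂ} (hK : K ⊆ {0}ᶜ) (w : ℂ) :
    ContinuousOn (fun a : ℂ => w / a) K :=
  continuousOn_const.div continuousOn_id fun _ ha => hK ha

theorem unifBdd_rightCoeff (hq : ‖q‖ < 1) {K : Set ℂ} (hK : IsCompact K) (h0 : K ⊆ {0}ᶜ) :
    UnifBdd K (rightCoeff q c d e z) := by
  have h1 := continuousOn_const_div h0
  unfold rightCoeff
  iterate 6 refine UnifBdd.mul ?_ (unifBdd_qInf hq hK (by fun_prop))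
  iterate 5 refine UnifBdd.mul ?_ (unifBdd_qFin hq hK (by fun_prop))
  exact unifBdd_vwpFactor hq hK (by fun_prop)

theorem differentiableOn_leftCoeff (hq : ‖q‖ < 1) (n : ℕ) (U : Set ℂ) :
    DifferentiableOn ℂ (leftCoeff q c d e z n) U := by
  unfold leftCoeff
  iterate 6 refine DifferentiableOn.mul ?_ (differentiableOn_qInf hq (by fun_prop))
  iterate 5 refine DifferentiableOn.mul ?_ (differentiableOn_qFin q n (by fun_prop))
  exact differentiableOn_vwpFactor q n (by fun_prop)

theorem differentiableOn_sixCoeff (hq : ‖q‖ < 1) (n : ℕ) (U : Set ℂ) :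
    DifferentiableOn ℂ (sixCoeff q c d e n) U := by
  unfold sixCoeff
  iterate 4 refine DifferentiableOn.mul ?_ (differentiableOn_qInf hq (by fun_prop))
  iterate 3 refine DifferentiableOn.mul ?_ (differentiableOn_qFin q n (by fun_prop))
  exact differentiableOn_vwpFactor q n (by fun_prop)

theorem differentiableOn_const_div (w : ℂ) :
    DifferentiableOn ℂ (fun a : ℂ => w / a) {0}ᶜ :=
  (differentiableOn_const _).div differentiableOn_id fun _ ha => ha

theorem differentiableOn_rightCoeff (hq : ‖q‖ < 1) (n : ℕ) :
    DifferentiableOn ℂ (rightCoeff q c d e z n) {0}ᶜ := by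
  have h1 := differentiableOn_const_div
  unfold rightCoeff
  iterate 6
    refine DifferentiableOn.mul ?_ (differentiableOn_qInf hq (by fun_prop))
  iterate 5
    refine DifferentiableOn.mul ?_ (differentiableOn_qFin q n (by fun_prop))
  exact differentiableOn_vwpFactor q n (by fun_prop)

theorem summable_leftSum (hq : ‖q‖ < 1) {a : ℂ} (ha : ‖a * q / z‖ < 1) :
    Summable fun n => leftCoeff q c d e z n a * (a * q / z) ^ n :=
  summable_of_unifBdd (U := {a | ‖a * q / z‖ < 1}) (g := fun a => a * q / z)
    (fun _ _ hK => unifBdd_leftCoeff c d e z hq hK) (by fun_prop) (fun _ h => h) ha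

theorem summable_sixSum (hq : ‖q‖ < 1) {a : ℂ} (ha : ‖a / z‖ < 1) :
    Summable fun n => sixCoeff q c d e n a * (a / z) ^ n :=
  summable_of_unifBdd (U := {a | ‖a / z‖ < 1}) (g := fun a => a / z)
    (fun _ _ hK => unifBdd_sixCoeff c d e hq hK) (by fun_prop) (fun _ h => h) ha

theorem summable_rightSum (hq : ‖q‖ < 1) {a : ℂ} (ha : a ≠ 0) :
    Summable fun n => rightCoeff q c d e z n a * q ^ n :=
  summable_of_unifBdd (U := {0}ᶜ) (g := fun _ => q)
    (fun _ h0 hK => unifBdd_rightCoeff c d e z hq hK h0) (by fun_prop) (fun _ _ => hq) ha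

theorem differentiableOn_leftSum (hq : ‖q‖ < 1) :
    DifferentiableOn ℂ (leftSum q c d e z) {a | ‖a * q / z‖ < 1} :=
  differentiableOn_tsum_of_unifBdd (isOpen_norm_lt_one (by fun_prop))
    (fun n => differentiableOn_leftCoeff c d e z hq n _)
    (fun _ _ hK => unifBdd_leftCoeff c d e z hq hK) (by fun_prop) (fun _ h => h)

theorem differentiableOn_sixSum (hq : ‖q‖ < 1) :
    DifferentiableOn ℂ (sixSum q c d e z) {a | ‖a / z‖ < 1} :=
  differentiableOn_tsum_of_unifBdd (isOpen_norm_lt_one (by fun_prop))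
    (fun n => differentiableOn_sixCoeff c d e hq n _)
    (fun _ _ hK => unifBdd_sixCoeff c d e hq hK) (by fun_prop) (fun _ h => h)

theorem differentiableOn_rightSum (hq : ‖q‖ < 1) :
    DifferentiableOn ℂ (rightSum q c d e z) {0}ᶜ :=
  differentiableOn_tsum_of_unifBdd isOpen_compl_singleton
    (fun n => differentiableOn_rightCoeff c d e z hq n)
    (fun _ h0 hK => unifBdd_rightCoeff c d e z hq hK h0) (g := fun _ => q) (by fun_prop)
    (fun _ _ => hq)

end Series


section Telescoping

theorem tsum_eq_of_telescoping {t H : ℕ → ℂ} {L : ℂ} (ht : Summable t) (h0 : t 0 = H 0)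
    (hs : ∀ n, t (n + 1) = H (n + 1) - H n) (hL : Tendsto H atTop (𝓝 L)) : ∑' n, t n = L := by
  have h1 : ∀ n, ∑ k ∈ Finset.range (n + 1), t k = H n := by
    intro n
    induction n with
    | zero => simpa using h0
    | succ n ih => rw [Finset.sum_range_succ, ih, hs]; ring
  refine tendsto_nhds_unique ((tendsto_add_atTop_iff_nat 1).2 ht.hasSum.tendsto_sum_nat) ?_
  simpa only [h1] using hL

end Telescoping

section RationalIdentities

variable {q c d e z : ℂ}

theorem prod_one_sub_mul (hz : z * q = c * d * e) (t : ℂ) :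
    (1 - c * t) * (1 - d * t) * (1 - e * t) =
      1 - (c + d + e) * t + (c * d + c * e + d * e) * t ^ 2 - z * q * t ^ 3 := by
  rw [hz]
  ring

theorem prod_one_sub_div (hc : c ≠ 0) (hd : d ≠ 0) (he : e ≠ 0)
    (hz : z * q = c * d * e) (t : ℂ) :
    (1 - t / c) * (1 - t / d) * (1 - t / e) =
      1 - (c * d + c * e + d * e) * t / (z * q) + (c + d + e) * t ^ 2 / (z * q) -
        t ^ 3 / (z * q) := by
  rw [hz]
  field_simp
  ring

theorem sixSum_identity (hq0 : q ≠ 0) (hz0 : z ≠ 0) (a x s₁ s₂ : ℂ) :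
    (1 - a / z) * (1 - a * x ^ 2) *
        (1 - s₂ * (a * q * x) / (z * q) + s₁ * (a * q * x) ^ 2 / (z * q) -
          (a * q * x) ^ 3 / (z * q)) -
      (1 - a * x) * (1 - a * q * x ^ 2) * x *
        (1 - s₁ * (a / z) + s₂ * (a / z) ^ 2 - z * q * (a / z) ^ 3) =
    -(1 - a * x) * (1 - s₁ * x + s₂ * x ^ 2 - z * q * x ^ 3) * (a / z) *
        (1 - a ^ 2 * (q * x) / z) +
      (1 - x) * (1 - a ^ 2 * x / z) * (1 - s₂ * (a * q * x) / (z * q) + s₁ * (a * q * x) ^ 2 / (z * q) -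
        (a * q * x) ^ 3 / (z * q)) := by
  field_simp
  ring

theorem sixSum_identity_zero (hq0 : q ≠ 0) (hz0 : z ≠ 0) (a s₁ s₂ : ℂ) :
    (1 - a / z) *
        (1 - s₂ * (a * q) / (z * q) + s₁ * (a * q) ^ 2 / (z * q) - (a * q) ^ 3 / (z * q)) -
      (1 - a * q) * (1 - s₁ * (a / z) + s₂ * (a / z) ^ 2 - z * q * (a / z) ^ 3) =
    -(1 - s₁ + s₂ - z * q) * (a / z) * (1 - a ^ 2 * q / z) := by
  field_simp
  ring

theorem leftSum_identity (hq0 : q ≠ 0) (hz0 : z ≠ 0) (a x s₁ s₂ : ℂ) :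
    (1 - a / z) * (1 - a * x ^ 2) *
        (1 - s₂ * (a * q * x) / (z * q) + s₁ * (a * q * x) ^ 2 / (z * q) -
          (a * q * x) ^ 3 / (z * q)) * (1 - a * q * x / z) -
      z * (1 - s₂ * (a * q / z) / (z * q) + s₁ * (a * q / z) ^ 2 / (z * q) -
          (a * q / z) ^ 3 / (z * q)) *
        (1 - a * x) * (1 - a * q * x ^ 2) * (1 - a * x / z) * x -
      (1 - z * x) * (1 - a ^ 2 * q / z ^ 2) * (1 - a * x) * (1 - a * q * x ^ 2) *
        (1 - a * x / z) * (1 - a * q * x / z) =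
    a / z * ((1 - a * x) * (1 - s₁ * x + s₂ * x ^ 2 - z * q * x ^ 3) * (a * q / z) * (1 - z * x) *
        (1 - a * x / z) -
      (1 - x) * (1 - s₂ * (a * q * x) / (z * q) + s₁ * (a * q * x) ^ 2 / (z * q) -
          (a * q * x) ^ 3 / (z * q)) * (1 - z * x) * (1 - a * q * x / z)) := by
  field_simp
  ring

theorem leftSum_identity_zero (hq0 : q ≠ 0) (hz0 : z ≠ 0) (a s₁ s₂ : ℂ) :
    (1 - s₂ * (a * q) / (z * q) + s₁ * (a * q) ^ 2 / (z * q) - (a * q) ^ 3 / (z * q)) *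
        (1 - a * q / z) -
      z * (1 - s₂ * (a * q / z) / (z * q) + s₁ * (a * q / z) ^ 2 / (z * q) -
          (a * q / z) ^ 3 / (z * q)) * (1 - a * q) -
      (1 - z) * (1 - a ^ 2 * q / z ^ 2) * (1 - a * q) * (1 - a * q / z) =
    a / z * (1 - s₁ + s₂ - z * q) * (a * q / z) * (1 - z) := by
  field_simp
  ring

theorem rightSum_identity (hq0 : q ≠ 0) (hz0 : z ≠ 0) {a : ℂ} (ha : a ≠ 0) (x s₁ s₂ : ℂ) :
    (1 - s₁ * (a / z) + s₂ * (a / z) ^ 2 - z * q * (a / z) ^ 3) * (1 - x ^ 2 / z) * (1 - a / z) *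
        (1 - z * x / (a * q)) * (1 - a * q * x / z ^ 2) * x +
      a * (1 - s₂ * (a * q / z) / (z * q) + s₁ * (a * q / z) ^ 2 / (z * q) -
          (a * q / z) ^ 3 / (z * q)) *
        (1 - x ^ 2 / z) * (1 - a * x / z) * (1 - z / (a * q)) * (1 - x / a) * x =
    a * (1 - a ^ 2 * q / z ^ 2) * ((1 - a * x / z) * (1 - z * x / (a * q)) * (1 - x / z) *
        (1 - s₁ * (x / z) + s₂ * (x / z) ^ 2 - z * q * (x / z) ^ 3) -
      (1 - x) * (1 - s₂ * x / (z * q) + s₁ * x ^ 2 / (z * q) - x ^ 3 / (z * q)) * (1 - x / a) *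
        (1 - a * q * x / z ^ 2)) := by
  field_simp
  ring

theorem rightSum_identity_zero (hq0 : q ≠ 0) (hz0 : z ≠ 0) {a : ℂ} (ha : a ≠ 0) (s₁ s₂ : ℂ) :
    (1 - s₁ * (a / z) + s₂ * (a / z) ^ 2 - z * q * (a / z) ^ 3) * (1 - a * q / z ^ 2) +
      a * (1 - s₂ * (a * q / z) / (z * q) + s₁ * (a * q / z) ^ 2 / (z * q) -
          (a * q / z) ^ 3 / (z * q)) * (1 - 1 / a) =
    a * (1 - a ^ 2 * q / z ^ 2) *
      (1 - s₁ * (1 / z) + s₂ * (1 / z) ^ 2 - z * q * (1 / z) ^ 3) := by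
  field_simp
  ring

end RationalIdentities


section Shift

theorem qInf_qpow {q : ℂ} (hq : ‖q‖ < 1) (x : ℂ) (n : ℕ) :
    qInf q (x * q ^ n) = (1 - x * q ^ n) * qInf q (x * q ^ (n + 1)) := by
  rw [qInf_eq_mul hq, mul_assoc, ← pow_succ]

theorem vwpFactor_succ (q a : ℂ) (n : ℕ) :
    vwpFactor q a (n + 1) = (1 - a * (q ^ (n + 1)) ^ 2) * qFin q (a * q) n := by
  rw [vwpFactor, ← pow_mul, mul_comm (n + 1) 2]

theorem one_sub_mul_vwpFactor_succ (q a : ℂ) (n : ℕ) :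
    (1 - a * q) * vwpFactor q (a * q) (n + 1) =
      (1 - a * q * (q ^ (n + 1)) ^ 2) * (qFin q (a * q) n * (1 - a * q ^ (n + 1))) := by
  have h := qFin_succ q (a * q) n
  rw [qFin_succ'] at h
  rw [vwpFactor_succ]
  linear_combination (1 - a * q * (q ^ (n + 1)) ^ 2) * h

theorem tendsto_qInf_qpow {q : ℂ} (hq : ‖q‖ < 1) (x : ℂ) :
    Tendsto (fun n : ℕ => qInf q (x * q ^ n)) atTop (𝓝 1) := by
  have h := (tendsto_pow_atTop_nhds_zero_of_norm_lt_one hq).const_mul x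
  rw [mul_zero] at h
  simpa [Function.comp_def] using ((differentiable_qInf hq).continuous.tendsto 0).comp h

theorem tendsto_qInf_qpow_succ {q : ℂ} (hq : ‖q‖ < 1) (x : ℂ) :
    Tendsto (fun n : ℕ => qInf q (x * q ^ (n + 1))) atTop (𝓝 1) :=
  (tendsto_add_atTop_iff_nat 1).2 (tendsto_qInf_qpow hq x)

theorem tendsto_qFin_succ {q : ℂ} (hq : ‖q‖ < 1) (x : ℂ) :
    Tendsto (fun n : ℕ => qFin q x (n + 1)) atTop (𝓝 (qInf q x)) :=
  (tendsto_add_atTop_iff_nat 1).2 (tendsto_qFin hq x)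

end Shift

section SixPhiFive

variable {q c d e z : ℂ}

theorem sixSum_contiguous (hq0 : q ≠ 0) (hq : ‖q‖ < 1) (hz0 : z ≠ 0) (hc : c ≠ 0) (hd : d ≠ 0)
    (he : e ≠ 0) (hz : z * q = c * d * e) {a : ℂ} (ha : ‖a / z‖ < 1) :
    (1 - a / z) * sixSum q c d e z a =
      (1 - a * q) * ((1 - c * (a / z)) * (1 - d * (a / z)) * (1 - e * (a / z))) *
        sixSum q c d e z (a * q) := by
  have ha' : ‖a * q / z‖ < 1 := by
    rw [mul_div_right_comm, norm_mul]
    exact mul_lt_one_of_nonneg_of_lt_one_left (norm_nonneg _) ha hq.le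
  have hs₁ := (summable_sixSum c d e z hq ha).mul_left (1 - a / z)
  have hs₂ := (summable_sixSum c d e z hq ha').mul_left
    ((1 - a * q) * ((1 - c * (a / z)) * (1 - d * (a / z)) * (1 - e * (a / z))))
  rw [sixSum, sixSum, ← tsum_mul_left, ← tsum_mul_left, ← sub_eq_zero, ← hs₁.tsum_sub hs₂]
  refine tsum_eq_of_telescoping (hs₁.sub hs₂) (H := fun n => -(qFin q (a * q) n * qFin q c (n + 1) *
    qFin q d (n + 1) * qFin q e (n + 1) * qInf q (a * q / c * q ^ (n + 1)) *
    qInf q (a * q / d * q ^ (n + 1)) * qInf q (a * q / e * q ^ (n + 1)) * qInf q (q * q ^ n) *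
    (1 - a ^ 2 * q ^ (n + 1) / z)) * (a / z) ^ (n + 1)) ?_ ?_ ?_
  · have core := sixSum_identity_zero hq0 hz0 a (c + d + e) (c * d + c * e + d * e)
    have k₁ := prod_one_sub_mul hz (a / z)
    have k₂ := prod_one_sub_mul hz 1
    have k₃ := prod_one_sub_div hc hd he hz (a * q)
    simp only [one_pow, mul_one] at k₂
    rw [← k₁, ← k₂, ← k₃] at core
    simp only [sixCoeff, vwpFactor, qFin_zero, pow_zero, mul_one, one_mul, qFin_succ, zero_add,
      pow_one]
    rw [show a * q * q / c = a * q / c * q by ring, show a * q * q / d = a * q / d * q by ring,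
      show a * q * q / e = a * q / e * q by ring, qInf_eq_mul hq (a * q / c),
      qInf_eq_mul hq (a * q / d), qInf_eq_mul hq (a * q / e)]
    linear_combination qInf q (a * q / c * q) * qInf q (a * q / d * q) * qInf q (a * q / e * q) *
      qInf q q * core
  · intro n
    have core := sixSum_identity hq0 hz0 a (q ^ (n + 1)) (c + d + e) (c * d + c * e + d * e)
    rw [← prod_one_sub_mul hz, ← prod_one_sub_mul hz, ← prod_one_sub_div hc hd he hz] at core
    have hv := one_sub_mul_vwpFactor_succ q a n
    simp only [sixCoeff]
    rw [show a * q * q / c * q ^ (n + 1) = a * q / c * q ^ (n + 1 + 1) by ring,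
      show a * q * q / d * q ^ (n + 1) = a * q / d * q ^ (n + 1 + 1) by ring,
      show a * q * q / e * q ^ (n + 1) = a * q / e * q ^ (n + 1 + 1) by ring,
      vwpFactor_succ q a, qInf_qpow hq (a * q / c) (n + 1), qInf_qpow hq (a * q / d) (n + 1),
      qInf_qpow hq (a * q / e) (n + 1), qInf_qpow hq q n, qFin_succ q c (n + 1),
      qFin_succ q d (n + 1), qFin_succ q e (n + 1), qFin_succ q (a * q) n,
      show (a * q / z) ^ (n + 1) = (a / z) ^ (n + 1) * q ^ (n + 1) by rw [← mul_pow]; ring,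
      pow_succ (a / z) (n + 1), show a * q * q ^ n = a * q ^ (n + 1) by ring,
      show q * q ^ n = q ^ (n + 1) by ring, show q ^ (n + 1 + 1) = q * q ^ (n + 1) by ring]
    generalize q ^ (n + 1) = x at *
    linear_combination qFin q (a * q) n * qFin q c (n + 1) * qFin q d (n + 1) * qFin q e (n + 1) *
      qInf q (a * q / c * (q * x)) * qInf q (a * q / d * (q * x)) * qInf q (a * q / e * (q * x)) *
      qInf q (q * x) * (a / z) ^ (n + 1) * core -
      ((1 - c * (a / z)) * (1 - d * (a / z)) * (1 - e * (a / z))) * qFin q c (n + 1) *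
      qFin q d (n + 1) * qFin q e (n + 1) *
      qInf q (a * q / c * (q * x)) * qInf q (a * q / d * (q * x)) * qInf q (a * q / e * (q * x)) *
      qInf q (q * x) * (a / z) ^ (n + 1) * x * hv
  · have h1 : Tendsto (fun n : ℕ => 1 - a ^ 2 * q ^ (n + 1) / z) atTop (𝓝 (1 - a ^ 2 * 0 / z)) :=
      tendsto_const_nhds.sub (((tendsto_add_atTop_iff_nat 1).2
        (tendsto_pow_atTop_nhds_zero_of_norm_lt_one hq)).const_mul _ |>.div_const _)
    have h2 : Tendsto (fun n : ℕ => (a / z) ^ (n + 1)) atTop (𝓝 0) :=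
      (tendsto_add_atTop_iff_nat 1).2 (tendsto_pow_atTop_nhds_zero_of_norm_lt_one ha)
    have := (((((((((tendsto_qFin hq (a * q)).mul (tendsto_qFin_succ hq c)).mul
      (tendsto_qFin_succ hq d)).mul (tendsto_qFin_succ hq e)).mul
      (tendsto_qInf_qpow_succ hq (a * q / c))).mul (tendsto_qInf_qpow_succ hq (a * q / d))).mul
      (tendsto_qInf_qpow_succ hq (a * q / e))).mul (tendsto_qInf_qpow hq q)).mul h1).neg.mul h2
    simpa using this

theorem sixSum_zero (q c d e z : ℂ) : sixSum q c d e z 0 = qInf q q := by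
  rw [sixSum, tsum_eq_single 0 fun n hn => by simp [hn]]
  simp [sixCoeff, vwpFactor]

/-- The nonterminating `₆φ₅` summation. -/
theorem sixSum_eq (hq0 : q ≠ 0) (hq : ‖q‖ < 1) (hz0 : z ≠ 0) (hc : c ≠ 0) (hd : d ≠ 0)
    (he : e ≠ 0) (hz : z * q = c * d * e) {a : ℂ} (ha : ‖a / z‖ < 1) :
    sixSum q c d e z a * qInf q (a / z) =
      qInf q q * qInf q (a * q) *
        (qInf q (c * (a / z)) * qInf q (d * (a / z)) * qInf q (e * (a / z))) := by
  set J : ℂ → ℂ := fun a => sixSum q c d e z a * qInf q (a / z) - qInf q q * qInf q (a * q) *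
        (qInf q (c * (a / z)) * qInf q (d * (a / z)) * qInf q (e * (a / z))) with hJ
  suffices h : J a = 0 from sub_eq_zero.1 h
  have hstep : ∀ b : ℂ, ‖b / z‖ < 1 → J b = (1 - b * q) *
      ((1 - c * (b / z)) * (1 - d * (b / z)) * (1 - e * (b / z))) * J (b * q) := by
    intro b hb
    have h := sixSum_contiguous hq0 hq hz0 hc hd he hz hb
    simp only [hJ]
    rw [qInf_eq_mul hq (b / z), qInf_eq_mul hq (b * q), qInf_eq_mul hq (c * (b / z)),
      qInf_eq_mul hq (d * (b / z)), qInf_eq_mul hq (e * (b / z)),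
      show b / z * q = b * q / z by ring, show c * (b / z) * q = c * (b * q / z) by ring,
      show d * (b / z) * q = d * (b * q / z) by ring, show e * (b / z) * q = e * (b * q / z) by ring]
    linear_combination qInf q (b * q / z) * h
  have hnorm : ∀ n : ℕ, ‖a * q ^ n / z‖ < 1 := fun n => by
    rw [mul_div_right_comm, norm_mul, norm_pow]
    exact mul_lt_one_of_nonneg_of_lt_one_left (norm_nonneg _) ha
      (pow_le_one₀ (norm_nonneg _) hq.le)
  have hiter : ∀ n : ℕ, J a = qFin q (a * q) n * (qFin q (c * (a / z)) n *
      qFin q (d * (a / z)) n * qFin q (e * (a / z)) n) * J (a * q ^ n) := by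
    intro n
    induction n with
    | zero => simp
    | succ n ih =>
      rw [ih, hstep _ (hnorm n), qFin_succ, qFin_succ, qFin_succ, qFin_succ, pow_succ, mul_assoc a]
      ring
  have hcont : Tendsto J (𝓝 0) (𝓝 0) := by
    have hS : ContinuousAt (sixSum q c d e z) 0 :=
      ((differentiableOn_sixSum c d e z hq).differentiableAt
        ((isOpen_norm_lt_one (by fun_prop)).mem_nhds (by simp))).continuousAt
    have hP := (differentiable_qInf hq).continuous
    have hJc : ContinuousAt J 0 := by
      refine (hS.mul (hP.comp ?_).continuousAt).sub
        (Continuous.continuousAt ((continuous_const.mul (hP.comp ?_)).mul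
        (((hP.comp ?_).mul (hP.comp ?_)).mul (hP.comp ?_)))) <;> fun_prop
    have h0 : J 0 = 0 := by simp [hJ, sixSum_zero]
    simpa [ContinuousAt, h0] using hJc
  have hseq : Tendsto (fun n : ℕ => a * q ^ n) atTop (𝓝 0) := by
    simpa using (tendsto_pow_atTop_nhds_zero_of_norm_lt_one hq).const_mul a
  have hlim := ((tendsto_qFin hq (a * q)).mul (((tendsto_qFin hq (c * (a / z))).mul
    (tendsto_qFin hq (d * (a / z)))).mul (tendsto_qFin hq (e * (a / z))))).mul (hcont.comp hseq)
  rw [mul_zero] at hlim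
  exact tendsto_nhds_unique (tendsto_const_nhds.congr hiter) hlim

end SixPhiFive

section Contiguous

variable {q c d e z : ℂ}

theorem leftSum_contiguous_sixSum (hq0 : q ≠ 0) (hq : ‖q‖ < 1) (hz0 : z ≠ 0) (hc : c ≠ 0)
    (hd : d ≠ 0) (he : e ≠ 0) (hz : z * q = c * d * e) {a : ℂ} (ha : ‖a * q / z‖ < 1) :
    leftSum q c d e z a =
      z * ((1 - a * q / z / c) * (1 - a * q / z / d) * (1 - a * q / z / e)) * (1 - a * q) *
          leftSum q c d e z (a * q) +
        (1 - z) * qInf q (z * q) * (1 - a * q) * (1 - a ^ 2 * q / z ^ 2) * qInf q (a * q / z) *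
          sixSum q c d e z (a * q) := by
  have ha' : ‖a * q * q / z‖ < 1 := by
    rw [mul_div_right_comm, norm_mul]
    exact mul_lt_one_of_nonneg_of_lt_one_left (norm_nonneg _) ha hq.le
  have hs₁ := summable_leftSum c d e z hq ha
  have hs₂ := (summable_leftSum c d e z hq ha').mul_left
    (z * ((1 - a * q / z / c) * (1 - a * q / z / d) * (1 - a * q / z / e)) * (1 - a * q))
  have hs₃ := (summable_sixSum c d e z hq ha).mul_left
    ((1 - z) * qInf q (z * q) * (1 - a * q) * (1 - a ^ 2 * q / z ^ 2) * qInf q (a * q / z))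
  rw [← sub_eq_zero, ← sub_sub, leftSum, leftSum, sixSum, ← tsum_mul_left, ← tsum_mul_left,
    ← hs₁.tsum_sub hs₂, ← (hs₁.sub hs₂).tsum_sub hs₃]
  refine tsum_eq_of_telescoping ((hs₁.sub hs₂).sub hs₃) (H := fun n => a / z *
    (qFin q (a * q) n * qFin q c (n + 1) * qFin q d (n + 1) * qFin q e (n + 1) *
    qFin q (a * q / z) n * ((1 - z) * qInf q (z * q)) *
    qInf q (a * q / c * q ^ (n + 1)) * qInf q (a * q / d * q ^ (n + 1)) *
    qInf q (a * q / e * q ^ (n + 1)) * qInf q (a * q / z * q ^ (n + 1)) * qInf q (q * q ^ n)) *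
    (a * q / z) ^ (n + 1)) ?_ ?_ ?_
  · have core := leftSum_identity_zero hq0 hz0 a (c + d + e) (c * d + c * e + d * e)
    have k₂ := prod_one_sub_mul hz 1
    have k₃ := prod_one_sub_div hc hd he hz (a * q)
    simp only [one_pow, mul_one] at k₂
    rw [← k₂, ← k₃, ← prod_one_sub_div hc hd he hz] at core
    simp only [leftCoeff, sixCoeff, vwpFactor, qFin_zero, pow_zero, mul_one, one_mul, qFin_succ,
      zero_add, pow_one]
    rw [show a * q * q / c = a * q / c * q by ring, show a * q * q / d = a * q / d * q by ring,
      show a * q * q / e = a * q / e * q by ring, show a * q * q / z = a * q / z * q by ring,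
      qInf_eq_mul hq (a * q / c), qInf_eq_mul hq (a * q / d), qInf_eq_mul hq (a * q / e),
      qInf_eq_mul hq (a * q / z)]
    linear_combination qInf q (a * q / c * q) * qInf q (a * q / d * q) * qInf q (a * q / e * q) *
      qInf q (a * q / z * q) * qInf q (z * q) * qInf q q * core
  · intro n
    have core := leftSum_identity hq0 hz0 a (q ^ (n + 1)) (c + d + e) (c * d + c * e + d * e)
    rw [← prod_one_sub_mul hz, ← prod_one_sub_div hc hd he hz, ← prod_one_sub_div hc hd he hz]
      at core
    have hv := one_sub_mul_vwpFactor_succ q a n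
    have hzq : (1 - z) * qInf q (z * q) =
        qFin q z (n + 1) * ((1 - z * q ^ (n + 1)) * qInf q (z * q * q ^ (n + 1))) := by
      rw [← qInf_eq_mul hq, ← qFin_mul_qInf hq z (n + 1), qInf_qpow hq]
      ring_nf
    have hzz : qInf q (a * q / z) = qFin q (a * q / z) n * ((1 - a * q / z * q ^ n) *
        ((1 - a * q / z * q ^ (n + 1)) * qInf q (a * q / z * q ^ (n + 1 + 1)))) := by
      rw [← qInf_qpow hq, ← qInf_qpow hq, qFin_mul_qInf hq]
    simp only [leftCoeff, sixCoeff]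
    rw [hzq, hzz, show a * q * q / c * q ^ (n + 1) = a * q / c * q ^ (n + 1 + 1) by ring,
      show a * q * q / d * q ^ (n + 1) = a * q / d * q ^ (n + 1 + 1) by ring,
      show a * q * q / e * q ^ (n + 1) = a * q / e * q ^ (n + 1 + 1) by ring,
      show a * q * q / z * q ^ (n + 1) = a * q / z * q ^ (n + 1 + 1) by ring,
      vwpFactor_succ q a, qInf_qpow hq (a * q / c) (n + 1), qInf_qpow hq (a * q / d) (n + 1),
      qInf_qpow hq (a * q / e) (n + 1), qInf_qpow hq (a * q / z) (n + 1), qInf_qpow hq q n,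
      qFin_succ q c (n + 1),
      qFin_succ q d (n + 1), qFin_succ q e (n + 1), qFin_succ q (a * q) n,
      qFin_succ q (a * q / z) n, qFin_succ' q (a / z) n, show a / z * q = a * q / z by ring,
      show (a * q * q / z) ^ (n + 1) = (a * q / z) ^ (n + 1) * q ^ (n + 1) by rw [← mul_pow]; ring,
      pow_succ (a * q / z) (n + 1), show a * q * q ^ n = a * q ^ (n + 1) by ring,
      show a * q / z * q ^ n = a / z * q ^ (n + 1) by ring,
      show q * q ^ n = q ^ (n + 1) by ring, show q ^ (n + 1 + 1) = q * q ^ (n + 1) by ring]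
    generalize q ^ (n + 1) = x at *
    linear_combination qFin q (a * q) n * qFin q c (n + 1) * qFin q d (n + 1) * qFin q e (n + 1) *
      qFin q (a * q / z) n * qFin q z (n + 1) *
      qInf q (a * q / c * (q * x)) * qInf q (a * q / d * (q * x)) * qInf q (a * q / e * (q * x)) *
      qInf q (a * q / z * (q * x)) * qInf q (z * q * x) *
      qInf q (q * x) * (a * q / z) ^ (n + 1) * core -
      (z * ((1 - a * q / z / c) * (1 - a * q / z / d) * (1 - a * q / z / e)) * x +
        (1 - z * x) * (1 - a ^ 2 * q / z ^ 2) * (1 - a * q / z * x)) *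
      (1 - a / z * x) * qFin q c (n + 1) * qFin q d (n + 1) * qFin q e (n + 1) *
      qFin q (a * q / z) n * qFin q z (n + 1) *
      qInf q (a * q / c * (q * x)) * qInf q (a * q / d * (q * x)) * qInf q (a * q / e * (q * x)) *
      qInf q (a * q / z * (q * x)) * qInf q (z * q * x) *
      qInf q (q * x) * (a * q / z) ^ (n + 1) * hv
  · have h2 : Tendsto (fun n : ℕ => (a * q / z) ^ (n + 1)) atTop (𝓝 0) :=
      (tendsto_add_atTop_iff_nat 1).2 (tendsto_pow_atTop_nhds_zero_of_norm_lt_one ha)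
    have := ((((((((((((tendsto_qFin hq (a * q)).mul (tendsto_qFin_succ hq c)).mul
      (tendsto_qFin_succ hq d)).mul (tendsto_qFin_succ hq e)).mul
      (tendsto_qFin hq (a * q / z))).mul_const ((1 - z) * qInf q (z * q))).mul
      (tendsto_qInf_qpow_succ hq (a * q / c))).mul (tendsto_qInf_qpow_succ hq (a * q / d))).mul
      (tendsto_qInf_qpow_succ hq (a * q / e))).mul (tendsto_qInf_qpow_succ hq (a * q / z))).mul
      (tendsto_qInf_qpow hq q)).const_mul (a / z)).mul h2
    simpa using this

theorem leftSum_contiguous (hq0 : q ≠ 0) (hq : ‖q‖ < 1) (hz0 : z ≠ 0) (hc : c ≠ 0)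
    (hd : d ≠ 0) (he : e ≠ 0) (hz : z * q = c * d * e) {a : ℂ} (ha : ‖a * q / z‖ < 1) :
    leftSum q c d e z a =
      z * ((1 - a * q / z / c) * (1 - a * q / z / d) * (1 - a * q / z / e)) * (1 - a * q) *
          leftSum q c d e z (a * q) +
        (1 - z) * qInf q (z * q) * (1 - a ^ 2 * q / z ^ 2) * qInf q q * qInf q (a * q) *
          (qInf q (c * (a * q / z)) * qInf q (d * (a * q / z)) * qInf q (e * (a * q / z))) := by
  have h := leftSum_contiguous_sixSum hq0 hq hz0 hc hd he hz ha
  have h6 := sixSum_eq hq0 hq hz0 hc hd he hz ha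
  rw [h, qInf_eq_mul hq (a * q)]
  linear_combination (1 - z) * qInf q (z * q) * (1 - a * q) * (1 - a ^ 2 * q / z ^ 2) * h6

theorem rightSum_contiguous (hq0 : q ≠ 0) (hq : ‖q‖ < 1) (hz0 : z ≠ 0) (hc : c ≠ 0)
    (hd : d ≠ 0) (he : e ≠ 0) (hz : z * q = c * d * e) {a : ℂ} (ha : a ≠ 0) :
    (1 - c * (a / z)) * (1 - d * (a / z)) * (1 - e * (a / z)) * rightSum q c d e z a +
      a * ((1 - a * q / z / c) * (1 - a * q / z / d) * (1 - a * q / z / e)) *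
          rightSum q c d e z (a * q) =
        a * (1 - a ^ 2 * q / z ^ 2) * qInf q (a * q / z) * qInf q (z / a) * qInf q (q / z) *
          (qInf q (c / z) * qInf q (d / z) * qInf q (e / z)) := by
  have hs₁ := (summable_rightSum c d e z hq ha).mul_left
    ((1 - c * (a / z)) * (1 - d * (a / z)) * (1 - e * (a / z)))
  have hs₂ := (summable_rightSum c d e z hq (mul_ne_zero ha hq0)).mul_left
    (a * ((1 - a * q / z / c) * (1 - a * q / z / d) * (1 - a * q / z / e)))
  rw [rightSum, rightSum, ← tsum_mul_left, ← tsum_mul_left, ← hs₁.tsum_add hs₂]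
  refine tsum_eq_of_telescoping (hs₁.add hs₂) (H := fun n => a * (1 - a ^ 2 * q / z ^ 2) *
    qFin q (a * q / z) n * qFin q (z / a) n * qFin q (q / z) n *
    (qFin q (c / z) (n + 1) * qFin q (d / z) (n + 1) * qFin q (e / z) (n + 1)) *
    (qInf q (q / a * q ^ n) * qInf q (a * q / z ^ 2 * q ^ (n + 1)) * qInf q (q / c * q ^ n) *
    qInf q (q / d * q ^ n) * qInf q (q / e * q ^ n) * qInf q (q * q ^ n))) ?_ ?_ ?_
  · have core := rightSum_identity_zero hq0 hz0 ha (c + d + e) (c * d + c * e + d * e)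
    rw [← prod_one_sub_mul hz, ← prod_one_sub_mul hz, ← prod_one_sub_div hc hd he hz] at core
    simp only [rightCoeff, vwpFactor, qFin_zero, pow_zero, mul_one, one_mul, qFin_succ,
      zero_add, pow_one]
    rw [show a * q * q / z ^ 2 = a * q / z ^ 2 * q by ring,
      show q / (a * q) = 1 / a by field_simp, qInf_eq_mul hq (a * q / z ^ 2),
      qInf_eq_mul hq (1 / a), show 1 / a * q = q / a by ring]
    linear_combination qInf q (q / c) * qInf q (q / d) * qInf q (q / e) * qInf q (q / a) *
      qInf q (a * q / z ^ 2 * q) * qInf q q * core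
  · intro n
    have core := rightSum_identity hq0 hz0 ha (q ^ (n + 1)) (c + d + e) (c * d + c * e + d * e)
    rw [← prod_one_sub_mul hz, ← prod_one_sub_mul hz, ← prod_one_sub_div hc hd he hz,
      ← prod_one_sub_div hc hd he hz] at core
    simp only [rightCoeff]
    rw [show a * q * q / z ^ 2 * q ^ (n + 1) = a * q / z ^ 2 * q ^ (n + 1 + 1) by ring,
      show q / (a * q) * q ^ (n + 1) = q / a * q ^ n by field_simp; ring,
      vwpFactor_succ q (1 / z), qInf_qpow hq (a * q / z ^ 2) (n + 1), qInf_qpow hq (q / a) n,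
      qInf_qpow hq (q / c) n, qInf_qpow hq (q / d) n, qInf_qpow hq (q / e) n, qInf_qpow hq q n,
      qFin_succ q (c / z) (n + 1), qFin_succ q (d / z) (n + 1), qFin_succ q (e / z) (n + 1),
      qFin_succ q (z / a) n, qFin_succ q (a * q / z) n, qFin_succ q (q / z) n,
      qFin_succ' q (a / z) n, qFin_succ' q (z / (a * q)) n, show a / z * q = a * q / z by ring,
      show z / (a * q) * q = z / a by field_simp, show 1 / z * q = q / z by ring,
      show z / a * q ^ n = z / (a * q) * q ^ (n + 1) by field_simp; ring,
      show q / z * q ^ n = q ^ (n + 1) / z by ring,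
      show q / a * q ^ n = q ^ (n + 1) / a by ring, show q / c * q ^ n = q ^ (n + 1) / c by ring,
      show q / d * q ^ n = q ^ (n + 1) / d by ring, show q / e * q ^ n = q ^ (n + 1) / e by ring,
      show a * q / z * q ^ n = a / z * q ^ (n + 1) by ring,
      show q * q ^ n = q ^ (n + 1) by ring, show q ^ (n + 1 + 1) = q * q ^ (n + 1) by ring]
    generalize q ^ (n + 1) = x at *
    linear_combination qFin q (a * q / z) n * qFin q (z / a) n * qFin q (q / z) n *
      qFin q (c / z) (n + 1) * qFin q (d / z) (n + 1) * qFin q (e / z) (n + 1) *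
      qInf q (q / a * x) * qInf q (a * q / z ^ 2 * (q * x)) * qInf q (q / c * x) *
      qInf q (q / d * x) * qInf q (q / e * x) * qInf q (q * x) * core
  · have := (((((tendsto_qFin hq (a * q / z)).const_mul (a * (1 - a ^ 2 * q / z ^ 2))).mul
      (tendsto_qFin hq (z / a))).mul (tendsto_qFin hq (q / z))).mul
      (((tendsto_qFin_succ hq (c / z)).mul (tendsto_qFin_succ hq (d / z))).mul
      (tendsto_qFin_succ hq (e / z)))).mul ((((((tendsto_qInf_qpow hq (q / a)).mul
      (tendsto_qInf_qpow_succ hq (a * q / z ^ 2))).mul (tendsto_qInf_qpow hq (q / c))).mul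
      (tendsto_qInf_qpow hq (q / d))).mul (tendsto_qInf_qpow hq (q / e))).mul
      (tendsto_qInf_qpow hq q))
    simpa using this

end Contiguous


section QDifference

/-- If `f` vanishes wherever `g` does and the zeros of `g` are simple, then `g` divides `f`. -/
theorem exists_differentiableOn_mul_eq {U : Set ℂ} (hU : IsOpen U) {f g : ℂ → ℂ}
    (hf : DifferentiableOn ℂ f U) (hg : DifferentiableOn ℂ g U)
    (h0 : ∀ a ∈ U, g a = 0 → f a = 0 ∧ deriv g a ≠ 0) :
    ∃ h : ℂ → ℂ, DifferentiableOn ℂ h U ∧ ∀ a ∈ U, f a = g a * h a := by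
  classical
  refine ⟨fun a => if g a = 0 then deriv f a / deriv g a else f a / g a, fun a ha => ?_,
    fun a ha => ?_⟩
  · have hUa := hU.mem_nhds ha
    refine DifferentiableAt.differentiableWithinAt ?_
    by_cases hga : g a = 0
    · obtain ⟨hfa, hd⟩ := h0 a ha hga
      have hdf := ((Complex.differentiableOn_dslope hUa).2 hf).differentiableAt hUa
      have hdg := ((Complex.differentiableOn_dslope hUa).2 hg).differentiableAt hUa
      have hne : dslope g a a ≠ 0 := by rwa [dslope_same]
      refine (hdf.div hdg hne).congr_of_eventuallyEq ?_
      filter_upwards [hdg.continuousAt.eventually_ne hne] with b hb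
      rcases eq_or_ne b a with rfl | hba
      · simp [hga]
      · have h1 : f b = (b - a) * dslope f a b := by
          have := sub_smul_dslope f a b
          rw [hfa, sub_zero, smul_eq_mul] at this
          exact this.symm
        have h2 : g b = (b - a) * dslope g a b := by
          have := sub_smul_dslope g a b
          rw [hga, sub_zero, smul_eq_mul] at this
          exact this.symm
        have h3 : b - a ≠ 0 := sub_ne_zero.2 hba
        rw [if_neg (by rw [h2]; exact mul_ne_zero h3 hb), h1, h2, Pi.div_apply]
        field_simp
    · refine ((hf.differentiableAt hUa).div (hg.differentiableAt hUa) hga).congr_of_eventuallyEq ?_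
      filter_upwards [(hg.differentiableAt hUa).continuousAt.eventually_ne hga] with b hb
      rw [if_neg hb, Pi.div_apply]
  · dsimp only
    split_ifs with hga
    · rw [(h0 a ha hga).1, hga, zero_mul]
    · field_simp

theorem exists_bound_of_qDifference {q : ℂ} (hq0 : q ≠ 0) (hq : ‖q‖ < 1) {z : ℂ} (hz0 : z ≠ 0)
    {g κ : ℂ → ℂ} {r : ℝ} (hr : 0 < r) (hg : ContinuousOn g (Metric.ball 0 r \ {0}))
    (hκ : ContinuousAt κ 0) (hκ0 : κ 0 = z)
    (hrec : ∀ a ∈ Metric.ball 0 r \ {0}, g a = κ a * g (a * q)) :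
    ∃ ρ : ℝ, 0 < ρ ∧ ρ < r ∧ ∃ (M : ℕ) (C : ℝ), ∀ a : ℂ, a ≠ 0 → ‖a‖ ≤ ρ → ‖a ^ M * g a‖ ≤ C := by
  have hqn : 0 < ‖q‖ := norm_pos_iff.2 hq0
  have hzn : 0 < ‖z‖ := norm_pos_iff.2 hz0
  have hev : ∀ᶠ a in 𝓝 (0 : ℂ), ‖z‖ / 2 < ‖κ a‖ :=
    hκ.norm.eventually_const_lt (by simp only [hκ0]; linarith)
  obtain ⟨ε, hε, hball⟩ := Metric.eventually_nhds_iff.1 hev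
  obtain ⟨M, hM⟩ := exists_pow_lt_of_lt_one (half_pos hzn) hq
  set ρ := min ε r / 2 with hρ
  have hmin : 0 < min ε r := lt_min hε hr
  have hρ0 : 0 < ρ := half_pos hmin
  have hρε : ρ < ε := (half_lt_self hmin).trans_le (min_le_left _ _)
  have hρr : ρ < r := (half_lt_self hmin).trans_le (min_le_right _ _)
  have hstep : ∀ a : ℂ, a ≠ 0 → ‖a‖ ≤ ρ → ‖(a * q) ^ M * g (a * q)‖ ≤ ‖a ^ M * g a‖ := by
    intro a ha har
    have h1 := hrec a ⟨by simpa using har.trans_lt hρr, ha⟩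
    have h2 : ‖z‖ / 2 < ‖κ a‖ := hball (by simpa using har.trans_lt hρε)
    rw [h1, mul_pow, norm_mul, norm_mul, norm_mul, norm_mul, norm_pow q, mul_assoc]
    gcongr
    exact (hM.trans h2).le
  have hiter : ∀ (k : ℕ) (a : ℂ), a ≠ 0 → ‖a‖ ≤ ρ →
      ‖(a * q ^ k) ^ M * g (a * q ^ k)‖ ≤ ‖a ^ M * g a‖ := by
    intro k
    induction k with
    | zero => simp
    | succ k ih =>
      intro a ha har
      rw [pow_succ, ← mul_assoc]
      refine (hstep _ (mul_ne_zero ha (pow_ne_zero k hq0)) ?_).trans (ih a ha har)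
      rw [norm_mul, norm_pow]
      exact (mul_le_of_le_one_right (norm_nonneg _) (pow_le_one₀ hqn.le hq.le)).trans har
  have hK : IsCompact (Metric.closedBall (0 : ℂ) ρ \ Metric.ball 0 (‖q‖ * ρ)) :=
    (isCompact_closedBall _ _).diff Metric.isOpen_ball
  have hKsub : Metric.closedBall (0 : ℂ) ρ \ Metric.ball 0 (‖q‖ * ρ) ⊆ Metric.ball 0 r \ {0} := by
    rintro a ⟨h1, h2⟩
    refine ⟨Metric.closedBall_subset_ball hρr h1, ?_⟩
    rintro rfl
    exact h2 (Metric.mem_ball_self (by positivity))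
  obtain ⟨C, hC⟩ := hK.exists_bound_of_continuousOn
    (((continuous_pow M).continuousOn).mul (hg.mono hKsub))
  refine ⟨ρ, hρ0, hρr, M, C, fun a ha har => ?_⟩
  have han : 0 < ‖a‖ := norm_pos_iff.2 ha
  obtain ⟨k, hk1, hk2⟩ := exists_nat_pow_near_of_lt_one (div_pos han hρ0) ((div_le_one hρ0).2 har)
    hqn hq
  rw [lt_div_iff₀ hρ0] at hk1
  rw [div_le_iff₀ hρ0] at hk2
  have hqk := pow_ne_zero k hq0
  have hqkn : 0 < ‖q‖ ^ k := pow_pos hqn k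
  have hle : ‖a / q ^ k‖ ≤ ρ := by
    rw [norm_div, norm_pow, div_le_iff₀ hqkn]
    linarith
  have h3 := hiter k (a / q ^ k) (div_ne_zero ha hqk) hle
  rw [div_mul_cancel₀ _ hqk] at h3
  refine h3.trans (hC _ ⟨by simpa using hle, ?_⟩)
  simp only [Metric.mem_ball, dist_zero_right, not_lt]
  rw [norm_div, norm_pow, le_div_iff₀ hqkn]
  rw [pow_succ] at hk1
  linarith

/-- A solution of `g(a) = κ(a) g(aq)` that is holomorphic in a punctured neighbourhood of zero
vanishes identically near zero, unless `κ(0)` is an integer power of `q`. -/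
theorem eventually_eq_zero_of_qDifference {q : ℂ} (hq0 : q ≠ 0) (hq : ‖q‖ < 1) {z : ℂ}
    (hz0 : z ≠ 0) (hzq : ∀ m : ℤ, z * q ^ m ≠ 1) {g κ : ℂ → ℂ} {r : ℝ} (hr : 0 < r)
    (hg : DifferentiableOn ℂ g (Metric.ball 0 r \ {0})) (hκ : ContinuousAt κ 0) (hκ0 : κ 0 = z)
    (hrec : ∀ a ∈ Metric.ball 0 r \ {0}, g a = κ a * g (a * q)) :
    ∀ᶠ a in 𝓝[≠] 0, g a = 0 := by
  obtain ⟨ρ, hρ0, hρr, M, C, hC⟩ :=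
    exists_bound_of_qDifference hq0 hq hz0 hr hg.continuousOn hκ hκ0 hrec
  set G : ℂ → ℂ := fun a => a ^ M * g a with hG
  have hGd : DifferentiableOn ℂ G (Metric.ball 0 ρ \ {0}) :=
    ((differentiable_pow M).differentiableOn).mul
      (hg.mono (Set.sdiff_subset_sdiff_left (Metric.ball_subset_ball hρr.le)))
  have hnhds : Metric.ball (0 : ℂ) ρ ∈ 𝓝 0 := Metric.ball_mem_nhds _ hρ0
  have hb : BddAbove (norm ∘ G '' (Metric.ball 0 ρ \ {0})) := by
    refine ⟨C, ?_⟩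
    rintro _ ⟨a, ⟨ha1, ha2⟩, rfl⟩
    exact hC a ha2 (by simpa using (Metric.mem_ball.1 ha1).le)
  have hupd := Complex.differentiableOn_update_limUnder_of_bddAbove hnhds hGd hb
  set E := Function.update G 0 (limUnder (𝓝[≠] 0) G) with hE
  have hEa : AnalyticAt ℂ E 0 := hupd.analyticAt hnhds
  have hEG : ∀ a, a ≠ 0 → E a = a ^ M * g a := fun a ha => by
    rw [hE, Function.update_of_ne ha]
  by_cases hzero : ∀ᶠ a in 𝓝 (0 : ℂ), E a = 0
  · filter_upwards [hzero.filter_mono nhdsWithin_le_nhds, self_mem_nhdsWithin] with a ha1 ha2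
    rw [hEG a ha2] at ha1
    exact (mul_eq_zero.1 ha1).resolve_left (pow_ne_zero M ha2)
  exfalso
  obtain ⟨m, h, hha, hh0, hev⟩ := hEa.exists_eventuallyEq_pow_smul_nonzero_iff.2 hzero
  have hqt : Tendsto (fun a : ℂ => a * q) (𝓝 0) (𝓝 0) := by
    simpa using (continuous_mul_const q).tendsto 0
  have hkey : ∀ᶠ a in 𝓝[≠] (0 : ℂ), q ^ M * h a = κ a * (q ^ m * h (a * q)) := by
    filter_upwards [hev.filter_mono nhdsWithin_le_nhds,
      (hqt.eventually hev).filter_mono nhdsWithin_le_nhds, self_mem_nhdsWithin,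
      nhdsWithin_le_nhds (Metric.ball_mem_nhds (0 : ℂ) hr)] with a h1 h2 h3 h4
    have h3' : a ≠ 0 := h3
    have h5 := hrec a ⟨h4, h3⟩
    rw [hEG a h3, sub_zero, smul_eq_mul] at h1
    rw [hEG _ (mul_ne_zero h3' hq0), sub_zero, smul_eq_mul, mul_pow, mul_pow] at h2
    refine mul_left_cancel₀ (pow_ne_zero m h3') ?_
    linear_combination (-q ^ M) * h1 + κ a * h2 + q ^ M * a ^ M * h5
  have hl : Tendsto (fun a => q ^ M * h a) (𝓝[≠] 0) (𝓝 (q ^ M * h 0)) :=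
    (hha.continuousAt.tendsto.const_mul _).mono_left nhdsWithin_le_nhds
  have hr' : Tendsto (fun a => κ a * (q ^ m * h (a * q))) (𝓝[≠] 0) (𝓝 (κ 0 * (q ^ m * h 0))) :=
    (hκ.tendsto.mul ((hha.continuousAt.tendsto.comp hqt).const_mul _)).mono_left nhdsWithin_le_nhds
  have heq := tendsto_nhds_unique (hl.congr' hkey) hr'
  rw [hκ0, ← mul_assoc] at heq
  have heq' := mul_right_cancel₀ hh0 heq
  refine hzq (m - M) ?_
  rw [zpow_sub₀ hq0, zpow_natCast, zpow_natCast, ← mul_div_assoc, ← heq']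
  exact div_self (pow_ne_zero M hq0)

end QDifference


section ThreeTerm

variable {q c d e z : ℂ}

theorem deriv_qInf_ne_zero (hq0 : q ≠ 0) (hq : ‖q‖ < 1) {x : ℂ} {n : ℕ} (h : x * q ^ n = 1) :
    deriv (qInf q) x ≠ 0 := by
  have hf : DifferentiableAt ℂ (fun y => qFin q y n * qInf q (y * q ^ (n + 1))) x :=
    (differentiable_qFin q n x).mul ((differentiable_qInf hq).comp
      (differentiable_id.mul_const _) x)
  have hl : HasDerivAt (fun y : ℂ => 1 - y * q ^ n) (-(1 * q ^ n)) x :=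
    ((hasDerivAt_id x).mul_const _).const_sub 1
  have heq : qInf q = fun y => qFin q y n * qInf q (y * q ^ (n + 1)) * (1 - y * q ^ n) := by
    funext y
    rw [← qFin_mul_qInf hq y n, qInf_qpow hq]
    ring
  have hd := hf.hasDerivAt.mul hl
  rw [heq, show (fun y => qFin q y n * qInf q (y * q ^ (n + 1)) * (1 - y * q ^ n)) =
    (fun y => qFin q y n * qInf q (y * q ^ (n + 1))) * fun y => 1 - y * q ^ n from rfl, hd.deriv, h,
    pow_succ, ← mul_assoc x, h, one_mul, one_mul, sub_self, mul_zero, zero_add]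
  refine mul_ne_zero (mul_ne_zero ?_ (qInf_ne_zero hq (self_mul_qpow_ne_one hq)))
    (neg_ne_zero.2 (pow_ne_zero n hq0))
  refine Finset.prod_ne_zero_iff.2 fun k hk hk0 => ?_
  obtain ⟨m, rfl⟩ : ∃ m, n = k + (m + 1) := ⟨n - k - 1, by have := Finset.mem_range.1 hk; lia⟩
  rw [pow_add, ← mul_assoc, ← sub_eq_zero.1 hk0, one_mul, pow_succ'] at h
  exact self_mul_qpow_ne_one hq m h

/-- The right-hand side of the three-term relation, multiplied by its denominators. -/
noncomputable def rightSide (q c d e z a : ℂ) : ℂ :=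
  (1 - 1 / z) * qInf q (z * q) * qInf q q * qInf q (a * q) *
      (qInf q (c * (a / z)) * qInf q (d * (a / z)) * qInf q (e * (a / z))) * rightSum q c d e z a +
    1 / z * qInf q q ^ 2 * qInf q (q / z) * (qInf q c * qInf q d * qInf q e) * qInf q (a * q) *
      qInf q (q / a) * qInf q a *
      (qInf q (a * q / z / c) * qInf q (a * q / z / d) * qInf q (a * q / z / e))

/-- The difference of the two sides of the three-term relation, multiplied by their
denominators. -/
noncomputable def threeTermDefect (q c d e z a : ℂ) : ℂ :=
  qInf q (a / z) * qInf q (q * z / a) *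
      (qInf q (q / z) * (qInf q (c / z) * qInf q (d / z) * qInf q (e / z))) * leftSum q c d e z a -
    rightSide q c d e z a

theorem rightSide_contiguous (hq0 : q ≠ 0) (hq : ‖q‖ < 1) (hz0 : z ≠ 0) (hc : c ≠ 0)
    (hd : d ≠ 0) (he : e ≠ 0) (hz : z * q = c * d * e) {a : ℂ} (ha : a ≠ 0) :
    rightSide q c d e z a =
      -a * (1 - a * q) * ((1 - a * q / z / c) * (1 - a * q / z / d) * (1 - a * q / z / e)) *
          rightSide q c d e z (a * q) +
        (1 - 1 / z) * qInf q (z * q) * qInf q q * qInf q (a * q) *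
          (qInf q (c * (a * q / z)) * qInf q (d * (a * q / z)) * qInf q (e * (a * q / z))) *
          (a * (1 - a ^ 2 * q / z ^ 2) * qInf q (a * q / z) * qInf q (z / a) * qInf q (q / z) *
          (qInf q (c / z) * qInf q (d / z) * qInf q (e / z))) := by
  rw [← rightSum_contiguous hq0 hq hz0 hc hd he hz ha, rightSide, rightSide,
    qInf_eq_mul hq (c * (a / z)), qInf_eq_mul hq (d * (a / z)), qInf_eq_mul hq (e * (a / z)),
    qInf_eq_mul hq (a * q / z / c), qInf_eq_mul hq (a * q / z / d), qInf_eq_mul hq (a * q / z / e),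
    show q / (a * q) = 1 / a by field_simp, qInf_eq_mul hq (1 / a), show 1 / a * q = q / a by ring,
    qInf_eq_mul hq a, qInf_eq_mul hq (a * q),
    show c * (a / z) * q = c * (a * q / z) by ring, show d * (a / z) * q = d * (a * q / z) by ring,
    show e * (a / z) * q = e * (a * q / z) by ring,
    show a * q / z / c * q = a * q * q / z / c by ring,
    show a * q / z / d * q = a * q * q / z / d by ring,
    show a * q / z / e * q = a * q * q / z / e by ring]
  field_simp
  ring

theorem threeTermDefect_contiguous (hq0 : q ≠ 0) (hq : ‖q‖ < 1) (hz0 : z ≠ 0) (hc : c ≠ 0)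
    (hd : d ≠ 0) (he : e ≠ 0) (hz : z * q = c * d * e) {a : ℂ} (ha : a ≠ 0)
    (haz : ‖a * q / z‖ < 1) :
    threeTermDefect q c d e z a =
      -a * (1 - a * q) * ((1 - a * q / z / c) * (1 - a * q / z / d) * (1 - a * q / z / e)) *
          threeTermDefect q c d e z (a * q) := by
  rw [threeTermDefect, threeTermDefect, rightSide_contiguous hq0 hq hz0 hc hd he hz ha,
    leftSum_contiguous hq0 hq hz0 hc hd he hz haz, show q * z / (a * q) = z / a by field_simp,
    qInf_eq_mul hq (a / z), qInf_eq_mul hq (z / a), show z / a * q = q * z / a by ring,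
    show a / z * q = a * q / z by ring]
  generalize qInf q (c * (a * q / z)) * qInf q (d * (a * q / z)) * qInf q (e * (a * q / z)) = A
  generalize qInf q (c / z) * qInf q (d / z) * qInf q (e / z) = B
  generalize (1 - a * q / z / c) * (1 - a * q / z / d) * (1 - a * q / z / e) = D
  field_simp
  ring

theorem qFin_one_succ (q : ℂ) (n : ℕ) : qFin q 1 (n + 1) = 0 := by
  rw [qFin_succ', sub_self, zero_mul]

theorem rightSide_self (q c d e : ℂ) (hq : ‖q‖ < 1) (hz0 : z ≠ 0) : rightSide q c d e z z = 0 := by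
  have hR : rightSum q c d e z z = qInf q (q / c) * qInf q (q / d) * qInf q (q / e) *
      qInf q (q / z) * qInf q (q / z) * qInf q q := by
    rw [rightSum, tsum_eq_single 0]
    · simp only [rightCoeff, vwpFactor, qFin_zero, pow_zero, mul_one, one_mul]
      rw [show z * q / z ^ 2 = q / z by field_simp]
    · intro n hn
      obtain ⟨m, rfl⟩ := Nat.exists_eq_succ_of_ne_zero hn
      simp [rightCoeff, div_self hz0, qFin_one_succ]
  rw [rightSide, hR, div_self hz0, show z * q / z = q by field_simp, qInf_eq_mul hq z]
  field_simp
  ring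

theorem rightSide_qpow (hq0 : q ≠ 0) (hq : ‖q‖ < 1) (hz0 : z ≠ 0) (hc : c ≠ 0)
    (hd : d ≠ 0) (he : e ≠ 0) (hz : z * q = c * d * e) (hzq : ∀ n : ℕ, z * q * q ^ n ≠ 1)
    (hqc : ∀ n : ℕ, q / c * q ^ n ≠ 1) (hqd : ∀ n : ℕ, q / d * q ^ n ≠ 1)
    (hqe : ∀ n : ℕ, q / e * q ^ n ≠ 1) (n : ℕ) : rightSide q c d e z (z * q ^ n) = 0 := by
  induction n with
  | zero => rw [pow_zero, mul_one, rightSide_self q c d e hq hz0]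
  | succ n ih =>
    have hn : z * q ^ n ≠ 0 := mul_ne_zero hz0 (pow_ne_zero n hq0)
    rw [rightSide_contiguous hq0 hq hz0 hc hd he hz hn,
      qInf_eq_zero hq (x := z / (z * q ^ n)) n (by field_simp)] at ih
    have hne : ∀ {w : ℂ}, (∀ n : ℕ, q / w * q ^ n ≠ 1) → 1 - z * q ^ n * q / z / w ≠ 0 := by
      intro w hw h
      refine hw n ?_
      rw [show q / w * q ^ n = z * q ^ n * q / z / w by field_simp]
      linear_combination -h
    have h1 : 1 - z * q ^ n * q ≠ 0 := fun h => hzq n (by linear_combination -h)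
    simp only [mul_zero, zero_mul, add_zero] at ih
    rw [pow_succ, ← mul_assoc]
    exact (mul_eq_zero.1 ih).resolve_left (mul_ne_zero (mul_ne_zero (neg_ne_zero.2 hn) h1)
      (mul_ne_zero (mul_ne_zero (hne hqc) (hne hqd)) (hne hqe)))

theorem differentiableOn_threeTermDefect (hq : ‖q‖ < 1) {U : Set ℂ} (hU : U ⊆ {0}ᶜ)
    (hUz : U ⊆ {a | ‖a * q / z‖ < 1}) : DifferentiableOn ℂ (threeTermDefect q c d e z) U := by
  have hL := (differentiableOn_leftSum c d e z hq).mono hUz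
  have hR := (differentiableOn_rightSum c d e z hq).mono hU
  have hi : ∀ w : ℂ, DifferentiableOn ℂ (fun a : ℂ => w / a) U :=
    fun w => (differentiableOn_const_div w).mono hU
  have hP : ∀ {g : ℂ → ℂ}, DifferentiableOn ℂ g U → DifferentiableOn ℂ (fun a => qInf q (g a)) U :=
    fun hg => differentiableOn_qInf hq hg
  have h1 := hP (hi (q * z))
  have h2 := hP (hi q)
  have h3 : DifferentiableOn ℂ (fun a => qInf q (a / z)) U := hP (by fun_prop)
  have h4 : DifferentiableOn ℂ (fun a => qInf q (a * q)) U := hP (by fun_prop)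
  have h5 : DifferentiableOn ℂ (fun a => qInf q a) U := hP (by fun_prop)
  have h6 : ∀ w, DifferentiableOn ℂ (fun a => qInf q (w * (a / z))) U := fun w => hP (by fun_prop)
  have h7 : ∀ w, DifferentiableOn ℂ (fun a => qInf q (a * q / z / w)) U := fun w => hP (by fun_prop)
  exact (((h3.mul h1).mul_const _).mul hL).sub (((((h4.const_mul _).mul
    (((h6 c).mul (h6 d)).mul (h6 e))).mul hR)).add (((((h4.const_mul _).mul h2).mul h5)).mul
    (((h7 c).mul (h7 d)).mul (h7 e))))

/-- The three-term relation, cleared of denominators. -/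
theorem threeTermDefect_eq_zero (hq0 : q ≠ 0) (hq : ‖q‖ < 1) (hz0 : z ≠ 0) (hc : c ≠ 0)
    (hd : d ≠ 0) (he : e ≠ 0) (hz : z * q = c * d * e) (hz1 : z ≠ 1)
    (hzq : ∀ n : ℕ, z * q * q ^ n ≠ 1) (hqz : ∀ n : ℕ, q / z * q ^ n ≠ 1)
    (hqc : ∀ n : ℕ, q / c * q ^ n ≠ 1) (hqd : ∀ n : ℕ, q / d * q ^ n ≠ 1)
    (hqe : ∀ n : ℕ, q / e * q ^ n ≠ 1) {a : ℂ} (ha : a ≠ 0) (haz : ‖a * q / z‖ < 1) :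
    threeTermDefect q c d e z a = 0 := by
  have hzpow : ∀ m : ℤ, z * q ^ m ≠ 1 := by
    intro m hm
    rcases lt_trichotomy m 0 with h | rfl | h
    · obtain ⟨n, rfl⟩ : ∃ n : ℕ, m = -((n + 1 : ℕ) : ℤ) := ⟨(-m - 1).toNat, by lia⟩
      refine hqz n ?_
      rw [zpow_neg, zpow_natCast] at hm
      have := pow_ne_zero (n + 1) hq0
      field_simp at hm ⊢
      rw [hm]
      ring
    · exact hz1 (by simpa using hm)
    · obtain ⟨n, rfl⟩ : ∃ n : ℕ, m = ((n + 1 : ℕ) : ℤ) := ⟨(m - 1).toNat, by lia⟩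
      refine hzq n ?_
      rw [zpow_natCast, pow_succ'] at hm
      rw [← hm]
      ring
  set B : Set ℂ := Metric.ball 0 ‖z‖ \ {0} with hB
  have hBopen : IsOpen B := Metric.isOpen_ball.sdiff isClosed_singleton
  have hB0 : B ⊆ {0}ᶜ := fun _ h => h.2
  have hBz : B ⊆ {a | ‖a * q / z‖ < 1} := by
    rintro b ⟨hb, -⟩
    change ‖b * q / z‖ < 1
    rw [mul_div_right_comm, norm_mul, norm_div]
    exact mul_lt_one_of_nonneg_of_lt_one_left (by positivity)
      ((div_lt_one (norm_pos_iff.2 hz0)).2 (by simpa using hb)) hq.le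
  have hBq : ∀ b ∈ B, b * q ∈ B := by
    rintro b ⟨hb, hb0⟩
    refine ⟨?_, mul_ne_zero hb0 hq0⟩
    simp only [Metric.mem_ball, dist_zero_right, norm_mul] at hb ⊢
    exact (mul_le_of_le_one_right (norm_nonneg _) hq.le).trans_lt hb
  have hinv : ∀ b ∈ B, HasDerivAt (fun b : ℂ => q * z / b) (-(q * z) / b ^ 2) b := by
    intro b hb
    exact ((hasDerivAt_inv (hB0 hb)).const_mul (q * z)).congr_deriv (by ring)
  have hder : ∀ b ∈ B, qInf q (q * z / b) = 0 →
      threeTermDefect q c d e z b = 0 ∧ deriv (fun b => qInf q (q * z / b)) b ≠ 0 := by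
    intro b hb hb0
    have hbne : b ≠ 0 := hB0 hb
    obtain ⟨n, hn⟩ : ∃ n : ℕ, q * z / b * q ^ n = 1 := by
      by_contra h
      exact qInf_ne_zero hq (fun n hn => h ⟨n, hn⟩) hb0
    have hbn : b = z * q ^ (n + 1) := by
      field_simp at hn
      rw [← hn]
      ring
    constructor
    · rw [threeTermDefect, hb0, hbn, rightSide_qpow hq0 hq hz0 hc hd he hz hzq hqc hqd hqe]
      ring
    · have h1 := ((differentiable_qInf hq (q * z / b)).hasDerivAt).comp b (hinv b hb)
      have h2 : deriv (fun b => qInf q (q * z / b)) b = _ := h1.deriv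
      rw [h2]
      exact mul_ne_zero (deriv_qInf_ne_zero hq0 hq hn)
        (div_ne_zero (neg_ne_zero.2 (mul_ne_zero hq0 hz0)) (pow_ne_zero 2 hbne))
  have hdP : DifferentiableOn ℂ (fun b => qInf q (q * z / b)) B :=
    differentiableOn_qInf hq ((differentiableOn_const_div (q * z)).mono hB0)
  obtain ⟨g, hg, hFg⟩ := exists_differentiableOn_mul_eq hBopen
    (differentiableOn_threeTermDefect (c := c) (d := d) (e := e) hq hB0 hBz) hdP hder
  set κ : ℂ → ℂ := fun a => (z - a) * (1 - a * q) *
    ((1 - a * q / z / c) * (1 - a * q / z / d) * (1 - a * q / z / e)) with hκ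
  have hκc : Continuous κ := by fun_prop
  have hrec₀ : ∀ b ∈ B, qInf q (q * z / b) ≠ 0 → g b = κ b * g (b * q) := by
    intro b hb hne
    have hbne : b ≠ 0 := hB0 hb
    have h1 := threeTermDefect_contiguous hq0 hq hz0 hc hd he hz hbne (hBz hb)
    rw [hFg b hb, hFg _ (hBq b hb), show q * z / (b * q) = z / b by field_simp,
      qInf_eq_mul hq (z / b), show z / b * q = q * z / b by ring] at h1
    refine mul_left_cancel₀ hne (h1.trans ?_)
    have h2 : b * (1 - z / b) = b - z := by field_simp
    rw [hκ]
    linear_combination -((1 - b * q) *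
      ((1 - b * q / z / c) * (1 - b * q / z / d) * (1 - b * q / z / e)) *
      qInf q (q * z / b) * g (b * q)) * h2
  have hrec : ∀ b ∈ B, g b = κ b * g (b * q) := by
    intro b hb
    by_cases hne : qInf q (q * z / b) = 0
    · have hev : ∀ᶠ x in 𝓝[≠] b, g x = κ x * g (x * q) := by
        have h1 := (hdP.differentiableAt (hBopen.mem_nhds hb)).hasDerivAt.eventually_ne
          (c := 0) (hder b hb hne).2
        filter_upwards [h1, nhdsWithin_le_nhds (hBopen.mem_nhds hb)] with x hx hxB
        exact hrec₀ x hxB hx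
      have hgb := (hg.differentiableAt (hBopen.mem_nhds hb)).continuousAt
      have hgbq := (hg.differentiableAt (hBopen.mem_nhds (hBq b hb))).continuousAt
      have hcomp : ContinuousAt (fun x => g (x * q)) b :=
        ContinuousAt.comp (f := fun x => x * q) hgbq (by fun_prop)
      exact tendsto_nhds_unique (hgb.tendsto.mono_left nhdsWithin_le_nhds)
        (((hκc.continuousAt.mul hcomp).tendsto.mono_left nhdsWithin_le_nhds).congr'
          (hev.mono fun _ h => h.symm))
    · exact hrec₀ b hb hne
  have hg0 := eventually_eq_zero_of_qDifference hq0 hq hz0 hzpow (norm_pos_iff.2 hz0) hg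
    hκc.continuousAt (by simp [hκ]) hrec
  have hF0 : ∀ᶠ b in 𝓝[≠] (0 : ℂ), threeTermDefect q c d e z b = 0 := by
    filter_upwards [hg0, self_mem_nhdsWithin,
      nhdsWithin_le_nhds (Metric.ball_mem_nhds (0 : ℂ) (norm_pos_iff.2 hz0))] with b h1 h2 h3
    rw [hFg b ⟨h3, h2⟩, h1, mul_zero]
  have hseq : Tendsto (fun n : ℕ => a * q ^ n) atTop (𝓝[≠] 0) := by
    refine tendsto_nhdsWithin_iff.2 ⟨?_, Eventually.of_forall fun n =>
      mul_ne_zero ha (pow_ne_zero n hq0)⟩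
    simpa using (tendsto_pow_atTop_nhds_zero_of_norm_lt_one hq).const_mul a
  obtain ⟨N, hN⟩ := (hseq.eventually hF0).exists
  have hdesc : ∀ (n : ℕ) (b : ℂ), b ≠ 0 → ‖b * q / z‖ < 1 →
      threeTermDefect q c d e z (b * q ^ n) = 0 → threeTermDefect q c d e z b = 0 := by
    intro n
    induction n with
    | zero => intro b _ _ h; simpa using h
    | succ n ih =>
      intro b hb hbz h
      have hbz' : ‖b * q * q / z‖ < 1 := by
        rw [mul_div_right_comm, norm_mul]
        exact mul_lt_one_of_nonneg_of_lt_one_left (norm_nonneg _) hbz hq.le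
      rw [threeTermDefect_contiguous hq0 hq hz0 hc hd he hz hb hbz,
        ih (b * q) (mul_ne_zero hb hq0) hbz' (by rw [← h]; ring_nf), mul_zero]
  exact hdesc N a ha haz hN

end ThreeTerm


section Assembly

variable {q c d e z a : ℂ}

theorem qInf_qpow_div_qInf (hq : ‖q‖ < 1) {x : ℂ} (h : ∀ n : ℕ, x * q ^ n ≠ 1) (n : ℕ) :
    (qFin q x n)⁻¹ = qInf q (x * q ^ n) / qInf q x := by
  have h1 := qInf_ne_zero hq h
  have h2 := qFin_ne_zero h n
  rw [eq_div_iff h1, ← qFin_mul_qInf hq x n]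
  field_simp

theorem WTerm_left (hq : ‖q‖ < 1) (ha : a ≠ 0) (hz0 : z ≠ 0)
    (hac : ∀ n : ℕ, a * q / c * q ^ n ≠ 1) (had : ∀ n : ℕ, a * q / d * q ^ n ≠ 1)
    (hae : ∀ n : ℕ, a * q / e * q ^ n ≠ 1) (hzq : ∀ n : ℕ, z * q * q ^ n ≠ 1)
    (haz : ∀ n : ℕ, a * q / z * q ^ n ≠ 1) (n : ℕ) :
    WTerm a [c, d, e, a / z, z] q (a * q / z) n =
      leftCoeff q c d e z n a * (a * q / z) ^ n /
        (qInf q (a * q / c) * qInf q (a * q / d) * qInf q (a * q / e) * qInf q (a * q / z) *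
          qInf q (z * q) * qInf q q) := by
  simp only [WTerm, qFins, List.map_cons, List.map_nil, List.prod_cons, List.prod_nil, mul_one,
    leftCoeff, div_eq_mul_inv _ (_ * _), div_eq_mul_inv _ (qFin q q n), mul_inv]
  rw [show a * q / (a / z) = z * q by field_simp, qInf_qpow_div_qInf hq hac,
    qInf_qpow_div_qInf hq had, qInf_qpow_div_qInf hq hae, qInf_qpow_div_qInf hq hzq,
    qInf_qpow_div_qInf hq haz, qInf_qpow_div_qInf hq (self_mul_qpow_ne_one hq)]
  ring

theorem WTerm_right (hq : ‖q‖ < 1) (ha : a ≠ 0) (hz0 : z ≠ 0) (hc : c ≠ 0) (hd : d ≠ 0)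
    (he : e ≠ 0) (hqa : ∀ n : ℕ, q / a * q ^ n ≠ 1) (hqc : ∀ n : ℕ, q / c * q ^ n ≠ 1)
    (hqd : ∀ n : ℕ, q / d * q ^ n ≠ 1) (hqe : ∀ n : ℕ, q / e * q ^ n ≠ 1)
    (hazz : ∀ n : ℕ, a * q / z ^ 2 * q ^ n ≠ 1) (n : ℕ) :
    WTerm (1 / z) [a / z, c / z, d / z, e / z, z / a] q q n =
      rightCoeff q c d e z n a * q ^ n /
        (qInf q (q / a) * qInf q (q / c) * qInf q (q / d) * qInf q (q / e) *
          qInf q (a * q / z ^ 2) * qInf q q) := by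
  simp only [WTerm, qFins, List.map_cons, List.map_nil, List.prod_cons, List.prod_nil, mul_one,
    rightCoeff, div_eq_mul_inv _ (_ * _), div_eq_mul_inv _ (qFin q q n), mul_inv]
  rw [show 1 / z * q / (a / z) = q / a by field_simp, show 1 / z * q / (c / z) = q / c by field_simp,
    show 1 / z * q / (d / z) = q / d by field_simp, show 1 / z * q / (e / z) = q / e by field_simp,
    show 1 / z * q / (z / a) = a * q / z ^ 2 by field_simp, qInf_qpow_div_qInf hq hqa,
    qInf_qpow_div_qInf hq hqc, qInf_qpow_div_qInf hq hqd, qInf_qpow_div_qInf hq hqe,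
    qInf_qpow_div_qInf hq hazz, qInf_qpow_div_qInf hq (self_mul_qpow_ne_one hq)]
  ring

end Assembly

end BasicHyp

open BasicHyp in
theorem mainTheorem10 (q a c d e z : ℂ)
    (hq0 : q ≠ 0) (hq1 : ‖q‖ < 1)
    (ha : a ≠ 0) (hc : c ≠ 0) (hd : d ≠ 0) (he : e ≠ 0)
    (hz : z * q = c * d * e) (hconv : ‖a * q / z‖ < 1)
    -- no denominator vanishes: `(aq/c, aq/d, aq/e, zq; q)_n`
    (hac : ∀ n : ℕ, a * q / c * q ^ n ≠ 1) (had : ∀ n : ℕ, a * q / d * q ^ n ≠ 1)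
    (hae : ∀ n : ℕ, a * q / e * q ^ n ≠ 1) (hzq : ∀ n : ℕ, z * q * q ^ n ≠ 1)
    -- `(q/a, q/c, q/d, q/e, aq/z²; q)_n`
    (hqa : ∀ n : ℕ, q / a * q ^ n ≠ 1) (hqc : ∀ n : ℕ, q / c * q ^ n ≠ 1)
    (hqd : ∀ n : ℕ, q / d * q ^ n ≠ 1) (hqe : ∀ n : ℕ, q / e * q ^ n ≠ 1)
    (hazz : ∀ n : ℕ, a * q / z ^ 2 * q ^ n ≠ 1)
    -- `θ(a/z)` and `(q/z, c/z, d/z, e/z; q)_∞`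
    (hth : ∀ m : ℤ, a / z * q ^ m ≠ 1) (hqz : ∀ n : ℕ, q / z * q ^ n ≠ 1)
    (hcz : ∀ n : ℕ, c / z * q ^ n ≠ 1) (hdz : ∀ n : ℕ, d / z * q ^ n ≠ 1)
    (hez : ∀ n : ℕ, e / z * q ^ n ≠ 1) :
    Summable (WTerm a [c, d, e, a / z, z] q (a * q / z)) ∧
    Summable (WTerm (1 / z) [a / z, c / z, d / z, e / z, z / a] q q) ∧
    W a [c, d, e, a / z, z] q (a * q / z)
      = (1 - 1 / z)
          * (qInfs q [q, a * q, q / a, a * q / z ^ 2] / (theta q (a / z) * qInf q (q / z)))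
          * (Omega q [q] [c, d, e] * Omega q [a * q] [c * d, c * e, d * e]
              / (Omega q [a * q] [c, d, e, z] * Omega q [1 / z] [1 / c, 1 / d, 1 / e]))
          * W (1 / z) [a / z, c / z, d / z, e / z, z / a] q q
        + 1 / z
          * (qInfs q [q, a * q, q / a, a] / (theta q (a / z) * qInf q (z * q)))
          * (Omega q [1] [1 / c, 1 / d, 1 / e] * Omega q [a * q / z] [c, d, e]
              / (Omega q [1 / z] [1 / c, 1 / d, 1 / e] * Omega q [a * q] [c, d, e, z])) := by
  have hz0 : z ≠ 0 := fun h => by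
    rw [h, zero_mul] at hz
    exact mul_ne_zero (mul_ne_zero hc hd) he hz.symm
  have haz : ∀ n : ℕ, a * q / z * q ^ n ≠ 1 := fun n => by
    have := hth (n + 1)
    rwa [zpow_add_one₀ hq0, zpow_natCast, show a / z * (q ^ n * q) = a * q / z * q ^ n by ring] at this
  have hL := WTerm_left hq1 ha hz0 hac had hae hzq haz
  have hR := WTerm_right hq1 ha hz0 hc hd he hqa hqc hqd hqe hazz
  have hLs : Summable (WTerm a [c, d, e, a / z, z] q (a * q / z)) := by
    rw [funext hL]
    exact (summable_leftSum c d e z hq1 hconv).div_const _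
  have hRs : Summable (WTerm (1 / z) [a / z, c / z, d / z, e / z, z / a] q q) := by
    rw [funext hR]
    exact (summable_rightSum c d e z hq1 ha).div_const _
  refine ⟨hLs, hRs, ?_⟩
  have hW₁ : W a [c, d, e, a / z, z] q (a * q / z) = leftSum q c d e z a /
      (qInf q (a * q / c) * qInf q (a * q / d) * qInf q (a * q / e) * qInf q (a * q / z) *
          qInf q (z * q) * qInf q q) := by
    rw [W, funext hL, tsum_div_const, leftSum]
  have hW₂ : W (1 / z) [a / z, c / z, d / z, e / z, z / a] q q = rightSum q c d e z a /
      (qInf q (q / a) * qInf q (q / c) * qInf q (q / d) * qInf q (q / e) *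
          qInf q (a * q / z ^ 2) * qInf q q) := by
    rw [W, funext hR, tsum_div_const, rightSum]
  have hθ := theta_eq_mul hq0 hq1 (div_ne_zero ha hz0)
  rw [show q / (a / z) = q * z / a by field_simp] at hθ
  have n₁ := qInf_ne_zero hq1 hac
  have n₂ := qInf_ne_zero hq1 had
  have n₃ := qInf_ne_zero hq1 hae
  have n₄ := qInf_ne_zero hq1 hzq
  have n₅ := qInf_ne_zero hq1 haz
  have n₆ := qInf_ne_zero hq1 hqa
  have n₇ := qInf_ne_zero hq1 hqc
  have n₈ := qInf_ne_zero hq1 hqd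
  have n₉ := qInf_ne_zero hq1 hqe
  have n₁₀ := qInf_ne_zero hq1 hazz
  have n₁₁ := qInf_ne_zero hq1 hqz
  have n₁₂ := qInf_ne_zero hq1 hcz
  have n₁₃ := qInf_ne_zero hq1 hdz
  have n₁₄ := qInf_ne_zero hq1 hez
  have n₁₅ := qInf_ne_zero hq1 (self_mul_qpow_ne_one hq1)
  have n₁₆ : qInf q (a / z) ≠ 0 := qInf_ne_zero hq1 fun n => by simpa using hth n
  have n₁₇ : qInf q (q * z / a) ≠ 0 := qInf_ne_zero hq1 fun n hn => by
    refine hth (-((n + 1 : ℕ) : ℤ)) ?_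
    rw [zpow_neg, zpow_natCast]
    have := pow_ne_zero (n + 1) hq0
    have h2 : q ^ (n + 1) * z = a := by
      field_simp at hn
      rw [← hn]
      ring
    rw [← h2]
    field_simp
  rw [hW₂, hθ]
  simp only [qInfs, Omega, List.map_cons, List.map_nil, List.prod_cons, List.prod_nil, mul_one]
  rw [show 1 / z / (1 / c) = c / z by field_simp, show 1 / z / (1 / d) = d / z by field_simp,
    show 1 / z / (1 / e) = e / z by field_simp, show 1 / (1 / c) = c by field_simp,
    show 1 / (1 / d) = d by field_simp, show 1 / (1 / e) = e by field_simp]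
  by_cases hz1 : z = 1
  · subst hz1
    have hW : W a [c, d, e, a / 1, 1] q (a * q / 1) = 1 := by
      rw [W, tsum_eq_single 0]
      · simp [WTerm, qFins, vwpFactor]
      · intro n hn
        obtain ⟨m, rfl⟩ := Nat.exists_eq_succ_of_ne_zero hn
        simp [WTerm, qFins, qFin_one_succ]
    rw [hW]
    simp only [div_one, sub_self, zero_mul, zero_add, one_mul, mul_one] at *
    field_simp
  · have key := threeTermDefect_eq_zero hq0 hq1 hz0 hc hd he hz hz1 hzq hqz hqc hqd hqe ha hconv
    rw [threeTermDefect, rightSide, sub_eq_zero] at key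
    rw [hW₁, show a * q / (c * d) = e * (a / z) by field_simp; linear_combination hz,
      show a * q / (c * e) = d * (a / z) by field_simp; linear_combination hz,
      show a * q / (d * e) = c * (a / z) by field_simp; linear_combination hz]
    generalize qInf q (a * q / c) = x₁ at *
    generalize qInf q (a * q / d) = x₂ at *
    generalize qInf q (a * q / e) = x₃ at *
    generalize qInf q (z * q) = x₄ at *
    generalize qInf q (a * q / z) = x₅ at *
    generalize qInf q (q / a) = x₆ at *
    generalize qInf q (q / c) = x₇ at *
    generalize qInf q (q / d) = x₈ at *
    generalize qInf q (q / e) = x₉ at *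
    generalize qInf q (a * q / z ^ 2) = x₁₀ at *
    generalize qInf q (q / z) = x₁₁ at *
    generalize qInf q (c / z) = x₁₂ at *
    generalize qInf q (d / z) = x₁₃ at *
    generalize qInf q (e / z) = x₁₄ at *
    generalize qInf q q = x₁₅ at *
    generalize qInf q (a / z) = x₁₆ at *
    generalize qInf q (q * z / a) = x₁₇ at *
    have key' : leftSum q c d e z a = _ / (x₁₆ * x₁₇ * (x₁₁ * (x₁₂ * x₁₃ * x₁₄))) :=
      eq_div_of_mul_eq (by simp [*]) ((mul_comm _ _).trans key)
    rw [key']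
    field_simp
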